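/- **Conventions.** A hypergraph $\mathcal H$ is a finite set $\mathit{edges}(\mathcal H)$ of finite sets (hyperedges) of natural numbers; $\mathit{nodes}(\mathcal H)$ is the union of its hyperedges. We write $\mathcal H\le\mathcal H'$ if every hyperedge of $\mathcal H$ is contained in a hyperedge of $\mathcal H'$. $\mathcal H$ is acyclic if it has a join tree: a tree whose vertices are the hyperedges of $\mathcal H$ such that, for each node $X$, the hyperedges containing $X$ induce a connected subtree. A tree projection of $\mathcal H_1$ with respect to $\mathcal H_2$ is an acyclic hypergraph $\mathcal H_a$ with $\mathcal H_1\le\mathcal H_a\le\mathcal H_2$. For a set $V$ of nodes, a $[V]$-path in $\mathcal H_1$ is a (possibly trivial) finite sequence of nodes in which any two consecutive nodes lie together in $h\setminus V$ for some $h\in\mathit{edges}(\mathcal H_1)$. A $[V]$-component is a maximal non-empty set $C\subseteq\mathit{nodes}(\mathcal H_1)\setminus V$ any two nodes of which are joined by a $[V]$-path. $\mathrm{Fr}(C)$ is the union of the hyperedges of $\mathcal H_1$ that meet $C$. **The Robber and Captain game on $(\mathcal H_1,\mathcal H_2)$.** A configuration is a triple $(h,M,C)$ of a squad $h$, a set $M\subseteq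 h$ of cops in action, and the set $C$ where the Robber is free to move; the initial one is $(\emptyset,\emptyset,\mathit{nodes}(\mathcal H_1))$. A strategy $\sigma$ maps each configuration $v=(h_p,M_p,C_p)$ of its domain to a pair $\sigma(v)=(h_r,M_r)$ with $h_r\in\mathit{edges}(\mathcal H_2)$ and $M_r\subseteq h_r\cap\mathrm{Fr}(C_p)$. The options of the Robber are then the $[M_r]$-components $C_r$ such that some node of $C_p$ is joined to some node of $C_r$ by an $[M_p\cap M_r]$-path (if $C_p$ is an $[M_p]$-component, this means that any two nodes of $C_p\cup C_r$ are joined by an $[M_p\cap M_r]$-path). The domain of $\sigma$ is the smallest set that contains the initial configuration and, with $v$, all $(h_r,M_r,C_r)$ for the options $C_r$. The strategy graph has an arc from each $v$ in the domain to each such $(h_r,M_r,C_r)$, and to $(h_r,M_r,\emptyset)$ if there is no option. The strategy $\sigma$ is *winning* if this graph has no directed cycle, and *greedy* if, for every $v=(h_p,M_p,C_p)$ in its domain, $M_r=h_r\cap\mathrm{Fr}(C_p)$, and $h_r=h_p$ whenever $h_p\cap C_p\ne\emptyset$. **Theorem 4.1.** There is a polynomial-time algorithm which, for every pair $(\mathcal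 H_1,\mathcal H_2)$ of hypergraphs such that the Captain has a greedy winning strategy in the Robber and Captain game on $(\mathcal H_1,\mathcal H_2)$, outputs a tree projection of $\mathcal H_1$ with respect to $\mathcal H_2$. Here a hypergraph is presented as a list of hyperedges, each a list of nodes written in binary, and the running time is bounded, on every pair of hypergraphs, by a fixed polynomial in the size of the presented input. -/

import Mathlib

namespace RobberCaptain

/-! ## Hypergraphs -/

/-- A finite hypergraph, given by its finite set of hyperedges. Every node is assumed to occur in
some hyperedge, so the node set is recovered as the union of the hyperedges, see `nodes`. -/
abbrev Hypergraph (α : Type*) := Finset (Finset α)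

section Hypergraphs

variable {α : Type*} [DecidableEq α]

/-- The nodes of a hypergraph: the union of its hyperedges. -/
def nodes (H : Hypergraph α) : Finset α := H.biUnion id

/-- `H₁ ≤ H₂` for hypergraphs: each hyperedge of `H₁` is contained in a hyperedge of `H₂`. -/
def CoveredBy (H₁ H₂ : Hypergraph α) : Prop := ∀ h ∈ H₁, ∃ h' ∈ H₂, h ⊆ h'

/-- `T` is a join tree of `H`: a tree whose vertices are the hyperedges of `H` and such that, for
every node `X`, the hyperedges that contain `X` induce a connected subgraph. -/
def IsJoinTree (H : Hypergraph α) (T : SimpleGraph {h : Finset α // h ∈ H}) : Prop :=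
  T.IsTree ∧ ∀ X ∈ nodes H, (T.induce {h | X ∈ h.1}).Connected

/-- (Alpha-)acyclicity of a hypergraph: it has a join tree. -/
def IsAcyclic (H : Hypergraph α) : Prop :=
  ∃ T : SimpleGraph {h : Finset α // h ∈ H}, IsJoinTree H T

/-- `Ha` is a tree projection of `H₁` with respect to `H₂`. -/
def IsTreeProjection (H₁ H₂ Ha : Hypergraph α) : Prop :=
  IsAcyclic Ha ∧ CoveredBy H₁ Ha ∧ CoveredBy Ha H₂

/-- `X` is `[V]`-adjacent to `Y`: some hyperedge `h` has `X, Y ∈ h - V`. -/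
def Adj (H : Hypergraph α) (V : Finset α) (X Y : α) : Prop :=
  ∃ h ∈ H, X ∈ h \ V ∧ Y ∈ h \ V

/-- There is a `[V]`-path (a finite, possibly trivial, sequence of `[V]`-adjacent nodes) from
`X` to `Y`. -/
def Path (H : Hypergraph α) (V : Finset α) (X Y : α) : Prop :=
  Relation.ReflTransGen (Adj H V) X Y

/-- `W` is `[V]`-connected. -/
def IsConnected (H : Hypergraph α) (V W : Finset α) : Prop :=
  ∀ X ∈ W, ∀ Y ∈ W, Path H V X Y

/-- `C` is a `[V]`-component: a maximal `[V]`-connected non-empty subset of `nodes H - V`. -/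
def IsComponent (H : Hypergraph α) (V C : Finset α) : Prop :=
  C.Nonempty ∧ C ⊆ nodes H \ V ∧ IsConnected H V C ∧
    ∀ C' : Finset α, C ⊆ C' → C' ⊆ nodes H \ V → IsConnected H V C' → C' = C

/-- The frontier `Fr(C)`: the union of the hyperedges that meet `C`. -/
def frontier (H : Hypergraph α) (C : Finset α) : Finset α :=
  (H.filter fun h => (h ∩ C).Nonempty).biUnion id

end Hypergraphs

/-! ## The Robber and Captain game -/

section Game

variable {α : Type*} [DecidableEq α]

/-- A position of the Captain: a squad together with the cops in action. -/
structure Position (α : Type*) where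
  squad : Finset α
  cops : Finset α

/-- A configuration: a position of the Captain and the set of nodes where the Robber is free to
move. The latter is empty in a capture configuration. -/
structure Config (α : Type*) where
  squad : Finset α
  cops : Finset α
  comp : Finset α

/-- The initial configuration `(∅, ∅, nodes H₁)`. -/
def initial (H₁ : Hypergraph α) : Config α := ⟨∅, ∅, nodes H₁⟩

/-- The options of the Robber when the Captain moves from the configuration `v` to the cops `M`:
the `[M]`-components that can be reached from the current set `v.comp` while only the cops in
`v.cops ∩ M` stay in place. If `v.comp` is a `[v.cops]`-component, this says that
`v.comp ∪ C` is `[v.cops ∩ M]`-connected, see `isOption_iff`; the formulation through reachability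
is also right at the initial configuration of a disconnected hypergraph. -/
def IsOption (H₁ : Hypergraph α) (v : Config α) (M C : Finset α) : Prop :=
  IsComponent H₁ M C ∧ ∃ X ∈ v.comp, ∃ Y ∈ C, Path H₁ (v.cops ∩ M) X Y

theorem Path.mono {H : Hypergraph α} {V V' : Finset α} (hV : V' ⊆ V) {X Y : α}
    (p : Path H V X Y) : Path H V' X Y := by
  refine Relation.ReflTransGen.mono (p := Adj H V') ?_ _ _ p
  rintro a b ⟨h, hh, ha, hb⟩
  simp only [Finset.mem_sdiff] at ha hb
  exact ⟨h, hh, Finset.mem_sdiff.2 ⟨ha.1, fun q => ha.2 (hV q)⟩,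
    Finset.mem_sdiff.2 ⟨hb.1, fun q => hb.2 (hV q)⟩⟩

theorem Path.symm {H : Hypergraph α} {V : Finset α} {X Y : α}
    (p : Path H V X Y) : Path H V Y X :=
  haveI : Std.Symm (Adj H V) := ⟨fun _ _ ⟨h, hh, ha, hb⟩ => ⟨h, hh, hb, ha⟩⟩
  (Relation.ReflTransGen.stdSymm (r := Adj H V)).symm _ _ p

theorem isOption_iff {H₁ : Hypergraph α} {v : Config α} {M C : Finset α}
    (hv : IsComponent H₁ v.cops v.comp) :
    IsOption H₁ v M C ↔
      IsComponent H₁ M C ∧ IsConnected H₁ (v.cops ∩ M) (v.comp ∪ C) := by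
  constructor
  · rintro ⟨hC, X, hX, Y, hY, p⟩
    have key : ∀ Z ∈ v.comp ∪ C, Path H₁ (v.cops ∩ M) X Z := by
      intro Z hZ
      rcases Finset.mem_union.1 hZ with hZ | hZ
      · exact (hv.2.2.1 X hX Z hZ).mono Finset.inter_subset_left
      · exact Relation.ReflTransGen.trans p
          ((hC.2.2.1 Y hY Z hZ).mono Finset.inter_subset_right)
    exact ⟨hC, fun Z hZ W hW => Relation.ReflTransGen.trans (key Z hZ).symm (key W hW)⟩
  · rintro ⟨hC, h⟩
    obtain ⟨X, hX⟩ := hv.1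
    obtain ⟨Y, hY⟩ := hC.1
    exact ⟨hC, X, hX, Y, hY,
      h X (Finset.mem_union_left _ hX) Y (Finset.mem_union_right _ hY)⟩

/-- The domain of a strategy: the configurations that occur in plays that start in the initial
configuration and in which the Captain moves according to `move`. -/
inductive InDomain (H₁ : Hypergraph α) (move : Config α → Position α) : Config α → Prop
  | init : InDomain H₁ move (initial H₁)
  | step {v : Config α} {C : Finset α} : InDomain H₁ move v →
      IsOption H₁ v (move v).cops C →
      InDomain H₁ move ⟨(move v).squad, (move v).cops, C⟩

/-- A strategy of the Captain. At each configuration of its domain it picks a squad of `H₂` and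
puts into action some cops of the squad that stand in the frontier of the Robber's component. The
values of `move` outside the domain play no role. -/
structure Strategy (H₁ H₂ : Hypergraph α) where
  move : Config α → Position α
  squad_mem : ∀ v, InDomain H₁ move v → (move v).squad ∈ H₂
  cops_subset : ∀ v, InDomain H₁ move v →
    (move v).cops ⊆ (move v).squad ∩ frontier H₁ v.comp

variable {H₁ H₂ : Hypergraph α}

/-- The arcs of the strategy graph: from a configuration in the domain to the configuration of
each option of the Robber, or to a capture configuration if there is no option. -/
def Strategy.Arc (σ : Strategy H₁ H₂) (v w : Config α) : Prop :=
  InDomain H₁ σ.move v ∧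
    w.squad = (σ.move v).squad ∧ w.cops = (σ.move v).cops ∧
    (IsOption H₁ v (σ.move v).cops w.comp ∨
      (w.comp = ∅ ∧ ∀ C, ¬ IsOption H₁ v (σ.move v).cops C))

/-- A strategy is winning if its strategy graph has no directed cycle. -/
def Strategy.IsWinning (σ : Strategy H₁ H₂) : Prop :=
  ∀ v : Config α, ¬ Relation.TransGen σ.Arc v v

/-- A strategy is greedy if it always activates all cops of the chosen squad that stand in the
frontier, and keeps the current squad as long as it meets the Robber's component. -/
def Strategy.IsGreedy (σ : Strategy H₁ H₂) : Prop :=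
  ∀ v, InDomain H₁ σ.move v →
    (σ.move v).cops = (σ.move v).squad ∩ frontier H₁ v.comp ∧
    ((v.squad ∩ v.comp).Nonempty → (σ.move v).squad = v.squad)

/-- The Captain has a greedy winning strategy in the game on `(H₁, H₂)`. -/
def HasGreedyWinningStrategy (H₁ H₂ : Hypergraph α) : Prop :=
  ∃ σ : Strategy H₁ H₂, σ.IsGreedy ∧ σ.IsWinning

end Game

/-! ## A model of computation with a running time

Programs of a small structured language that work on binary trees, the style being that of
`Turing.ToPartrec.Code`. The running time of every elementary operation is at least the size of the
data it reads, and forming a pair also pays for the size of the result. So all data in a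
computation of running time `t` have size `O(t)`, and Turing machines simulate these programs, and
are simulated by them, with polynomial overhead. -/

/-- Binary trees, the data that programs operate on. -/
inductive Data
  | nil
  | cons (a b : Data)
  deriving DecidableEq

namespace Data

/-- The number of constructors of a tree. -/
def size : Data → ℕ
  | nil => 1
  | cons a b => a.size + b.size + 1

/-- The left subtree (`nil` for the empty tree). -/
def hd : Data → Data
  | nil => nil
  | cons a _ => a

/-- The right subtree (`nil` for the empty tree). -/
def tl : Data → Data
  | nil => nil
  | cons _ b => b

/-- Truth values: `false` is `nil`, and `true` is a fixed other tree. -/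
def ofBool : Bool → Data
  | false => nil
  | true => cons nil nil

/-- Lists of trees as right-nested pairs. -/
def ofList : List Data → Data
  | [] => nil
  | a :: l => cons a (ofList l)

/-- Natural numbers in binary. -/
def ofNat (n : ℕ) : Data := ofList (n.bits.map ofBool)

/-- A list of lists of natural numbers. -/
def ofEdges (L : List (List ℕ)) : Data :=
  ofList (L.map fun e => ofList (e.map ofNat))

end Data

/-- Programs. Each one denotes a partial function from `Data` to `Data`. -/
inductive Prog
  /-- the identity -/
  | id
  /-- the constant `nil` -/
  | nil
  /-- left subtree -/
  | hd
  /-- right subtree -/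
  | tl
  /-- test whether the two subtrees are equal -/
  | eq
  /-- run both programs on the input and pair the results -/
  | pair (f g : Prog)
  /-- run `f`, and then `g` on its result -/
  | comp (g f : Prog)
  /-- run `f` if the test `c` gives a result other than `nil`, and `g` otherwise -/
  | ite (c f g : Prog)
  /-- repeat `f` as long as the test `c` gives a result other than `nil` -/
  | while (c f : Prog)

/-- `Run P x y t`: on input `x` the program `P` halts with output `y` after `t` time units. -/
inductive Run : Prog → Data → Data → ℕ → Prop
  | id (x : Data) : Run .id x x x.size
  | nil (x : Data) : Run .nil x .nil x.size
  | hd (x : Data) : Run .hd x x.hd x.size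
  | tl (x : Data) : Run .tl x x.tl x.size
  | eq (x : Data) : Run .eq x (.ofBool (decide (x.hd = x.tl))) x.size
  | pair {f g : Prog} {x y z : Data} {s t : ℕ} : Run f x y s → Run g x z t →
      Run (.pair f g) x (.cons y z) (x.size + s + t + (Data.cons y z).size)
  | comp {f g : Prog} {x y z : Data} {s t : ℕ} : Run f x y s → Run g y z t →
      Run (.comp g f) x z (x.size + s + t)
  | ite_true {c f g : Prog} {x b y : Data} {s t : ℕ} : Run c x b s → b ≠ .nil → Run f x y t →
      Run (.ite c f g) x y (x.size + s + t)
  | ite_false {c f g : Prog} {x y : Data} {s t : ℕ} : Run c x .nil s → Run g x y t →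
      Run (.ite c f g) x y (x.size + s + t)
  | while_true {c f : Prog} {x b y z : Data} {s t u : ℕ} : Run c x b s → b ≠ .nil →
      Run f x y t → Run (.while c f) y z u → Run (.while c f) x z (x.size + s + t + u)
  | while_false {c f : Prog} {x : Data} {s : ℕ} : Run c x .nil s →
      Run (.while c f) x x (x.size + s)

/-- Programs are deterministic: the output and the running time are unique. -/
theorem Run.unique {P : Prog} {x y y' : Data} {t t' : ℕ} (h : Run P x y t) (h' : Run P x y' t') :
    y = y' ∧ t = t' := by
  induction h generalizing y' t' with
  | id | nil | hd | tl | eq => cases h'; exact ⟨rfl, rfl⟩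
  | pair _ _ ih₁ ih₂ =>
    cases h' with
    | pair a b => obtain ⟨rfl, rfl⟩ := ih₁ a; obtain ⟨rfl, rfl⟩ := ih₂ b; exact ⟨rfl, rfl⟩
  | comp _ _ ih₁ ih₂ =>
    cases h' with
    | comp a b => obtain ⟨rfl, rfl⟩ := ih₁ a; obtain ⟨rfl, rfl⟩ := ih₂ b; exact ⟨rfl, rfl⟩
  | ite_true _ hb _ ih₁ ih₂ =>
    cases h' with
    | ite_true a _ b => obtain ⟨rfl, rfl⟩ := ih₁ a; obtain ⟨rfl, rfl⟩ := ih₂ b; exact ⟨rfl, rfl⟩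
    | ite_false a _ => exact absurd (ih₁ a).1 hb
  | ite_false _ _ ih₁ ih₂ =>
    cases h' with
    | ite_true a hb _ => exact absurd (ih₁ a).1.symm hb
    | ite_false a b => obtain ⟨_, rfl⟩ := ih₁ a; obtain ⟨rfl, rfl⟩ := ih₂ b; exact ⟨rfl, rfl⟩
  | while_true _ hb _ _ ih₁ ih₂ ih₃ =>
    cases h' with
    | while_true a _ b c =>
      obtain ⟨rfl, rfl⟩ := ih₁ a; obtain ⟨rfl, rfl⟩ := ih₂ b
      obtain ⟨rfl, rfl⟩ := ih₃ c; exact ⟨rfl, rfl⟩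
    | while_false a => exact absurd (ih₁ a).1 hb
  | while_false _ ih₁ =>
    cases h' with
    | while_true a hb _ _ => exact absurd (ih₁ a).1.symm hb
    | while_false a => obtain ⟨_, rfl⟩ := ih₁ a; exact ⟨rfl, rfl⟩

/-- The hypergraph that is presented by a list of hyperedges, each given by a list of nodes. Order
and repetitions are irrelevant. -/
def ofLists (L : List (List ℕ)) : Hypergraph ℕ := (L.map List.toFinset).toFinset

/-- The encoding of a pair of hypergraphs as an input of a program. -/
def encodePair (L₁ L₂ : List (List ℕ)) : Data := .cons (.ofEdges L₁) (.ofEdges L₂)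

end RobberCaptain

/-!
Write `∂C` for the nodes outside `C` that share a hyperedge of `H₁` with a node of `C`.

**Positions.** Against a greedy strategy only polynomially many positions matter, namely the
components `C` of squads (and, at the start, the connected components of `H₁`). A squad `h` that
meets the Robber's component is kept, and then the next move drives him into a component of `h`; and
if `h` does not meet his component `C`, then `C` is an `[h]`-component. If the Captain then moves to
`h'`, the cops that stay in place are those on `∂C ∩ h'`, so the Robber can go to the
`[h']`-components inside the region `R`, the component of `C` after removal of `∂C ∩ h'`. This is
`HasGreedyWinningStrategy.forall_isComponent`, an induction along the acyclic strategy graph.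

**From won positions to decompositions.** The strategy need not be monotone, so `R` may be larger
than `C`. Therefore a won position `C` is not decomposed itself. Instead, some connected set `D`
*absorbs* it: `C ⊆ D` and `∂D ⊆ ∂C`, and the hyperedges that meet `D` have a tree decomposition with
a root bag that contains `∂D`. Suppose that all `[h']`-components inside `R` are absorbed. Two
absorbing sets are disjoint or nested unless each of them contains the component that the other one
has been chosen for (`Absorbs.subset_or_disjoint`), so one can select pairwise disjoint absorbing
sets `Dᵢ` that cover `R` outside `h'` (`select_spec`). Then `D = R ∪ ⋃ Dᵢ` absorbs `C`: the part of
`h'` in `D ∪ ∂D` and outside all `Dᵢ` is the new root bag, it contains all `∂Dᵢ`, and the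
decompositions of the `Dᵢ` are attached to it (`Decomposes.glue`).

**The algorithm.** It keeps a table of sets `D` with their decompositions, and adds entries for
components that are not yet absorbed as long as possible. If there is a greedy winning strategy,
then all connected components end up absorbed (`absorbed_of_isComponent`), and gluing once more, with
`h' = ∅` and with all nodes as the region, gives the tree projection. Tree decompositions are built
bag by bag (`Grown`), from which the join tree is read off in `Grown.isAcyclic`.

**The running time.** `PolyTime` is closed under composition, case distinction and the usual list
functions, and under folds whose intermediate values have polynomially bounded size
(`PolyTime.foldl`). All sets of nodes are filtered out of the list of all nodes, and the bags of an
entry are filtered out of the root bags in the table, so the sizes stay polynomial.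
-/

namespace RobberCaptain

open Polynomial

/-! ### Polynomial-time functions -/

theorem eval_mono (p : ℕ[X]) {m n : ℕ} (h : m ≤ n) : p.eval m ≤ p.eval n := by
  simp only [eval_eq_sum, Polynomial.sum]
  gcongr

namespace Data

theorem one_le_size (x : Data) : 1 ≤ x.size := by cases x <;> simp [size]

theorem size_hd_le (x : Data) : x.hd.size ≤ x.size := by cases x <;> simp [hd, size]; omega

theorem size_tl_le (x : Data) : x.tl.size ≤ x.size := by cases x <;> simp [tl, size]; omega

theorem ofList_injective : Function.Injective ofList := by
  intro l
  induction l with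
  | nil => intro m h; cases m <;> simp_all [ofList]
  | cons a l ih =>
    intro m h
    cases m with
    | nil => simp [ofList] at h
    | cons b m => simp only [ofList, cons.injEq] at h; rw [h.1, ih h.2]

theorem ofBool_injective : Function.Injective ofBool := by
  intro a b; cases a <;> cases b <;> simp [ofBool]

end Data

theorem bits_injective : Function.Injective Nat.bits := by
  refine Function.LeftInverse.injective (g := fun l => l.foldr Nat.bit 0) fun n => ?_
  induction n using Nat.binaryRec' with
  | zero => simp
  | bit b n h ih => rw [Nat.bits_append_bit _ _ h]; exact congrArg (Nat.bit b) ih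

/-- Types whose elements are presented to programs through an injective encoding by trees. -/
class Enc (α : Type) where
  /-- The tree that presents an element. -/
  enc : α → Data
  enc_injective : Function.Injective enc

open Enc

instance : Enc Bool := ⟨Data.ofBool, Data.ofBool_injective⟩

instance : Enc ℕ :=
  ⟨Data.ofNat, Data.ofList_injective.comp
    ((List.map_injective_iff.2 Data.ofBool_injective).comp bits_injective)⟩

instance {α : Type} [Enc α] : Enc (List α) :=
  ⟨fun l => Data.ofList (l.map enc),
    Data.ofList_injective.comp (List.map_injective_iff.2 enc_injective)⟩

instance {α β : Type} [Enc α] [Enc β] : Enc (α × β) :=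
  ⟨fun a => .cons (enc a.1) (enc a.2), fun a b h => by
    rw [Data.cons.injEq] at h
    exact Prod.ext (enc_injective h.1) (enc_injective h.2)⟩

/-- The size of the encoding. -/
def esize {α : Type} [Enc α] (a : α) : ℕ := (enc a).size

section Size

variable {α β : Type} [Enc α] [Enc β]

theorem one_le_esize (a : α) : 1 ≤ esize a := Data.one_le_size _

theorem esize_pair (a : α × β) : esize a = esize a.1 + esize a.2 + 1 := rfl

@[simp] theorem esize_mk (a : α) (b : β) : esize (a, b) = esize a + esize b + 1 := rfl

@[simp] theorem esize_nil : esize ([] : List α) = 1 := rfl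

@[simp] theorem esize_cons (a : α) (l : List α) : esize (a :: l) = esize a + esize l + 1 := rfl

theorem esize_bool_le (b : Bool) : esize b ≤ 3 := by cases b <;> decide

theorem length_le_esize (l : List α) : l.length ≤ esize l := by
  induction l with
  | nil => simp
  | cons a l ih => simp; omega

theorem esize_append (l m : List α) : esize (l ++ m) + 1 = esize l + esize m := by
  induction l with
  | nil => simp; omega
  | cons a l ih => simp; omega

theorem esize_le_of_sublist {l m : List α} (h : l.Sublist m) : esize l ≤ esize m := by
  induction h with
  | slnil => exact le_rfl
  | cons _ _ ih => simp; omega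
  | cons_cons _ _ ih => simp; omega

theorem esize_le_of_mem {l : List α} {a : α} (h : a ∈ l) : esize a ≤ esize l := by
  have := esize_le_of_sublist (List.singleton_sublist.2 h)
  simp at this; omega

theorem esize_list_le {l : List α} {k : ℕ} (h : ∀ a ∈ l, esize a ≤ k) :
    esize l ≤ 1 + l.length * (k + 1) := by
  induction l with
  | nil => simp
  | cons a l ih =>
    have h₁ := h a (by simp)
    have h₂ := ih fun b hb => h b (by simp [hb])
    simp only [esize_cons, List.length_cons, add_mul]
    omega

end Size

/-- The factor accounts for the equality test, which may turn an input of size 1 into an output of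
size 3. -/
theorem Run.size_le {P : Prog} {x y : Data} {t : ℕ} (h : Run P x y t) :
    y.size ≤ x.size + 3 * t := by
  induction h with
  | id | nil x | hd x | tl x => 
    first
    | omega
    | (have := x.one_le_size; simp [Data.size]; omega)
    | (have := x.size_hd_le; omega)
    | (have := x.size_tl_le; omega)
  | eq x =>
    have := x.one_le_size
    by_cases h : x.hd = x.tl <;> simp [Data.ofBool, Data.size, h] <;> omega
  | pair | comp | ite_true | ite_false | while_true | while_false => omega

variable {α β γ σ : Type} [Enc α] [Enc β] [Enc γ] [Enc σ]

/-- Functions between encoded types that some program computes in polynomial time. -/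
@[fun_prop]
def PolyTime (f : α → β) : Prop :=
  ∃ (P : Prog) (p : ℕ[X]), ∀ a, ∃ t, Run P (enc a) (enc (f a)) t ∧ t ≤ p.eval (esize a)

namespace PolyTime

theorem size_le {f : α → β} (hf : PolyTime f) : ∃ p : ℕ[X], ∀ a, esize (f a) ≤ p.eval (esize a) := by
  obtain ⟨P, p, h⟩ := hf
  refine ⟨X + 3 * p, fun a => ?_⟩
  obtain ⟨t, hr, ht⟩ := h a
  have := hr.size_le
  simp only [eval_add, eval_X, eval_mul, eval_ofNat]
  unfold esize at *
  omega

theorem of_eq {f g : α → β} (hf : PolyTime f) (h : ∀ a, f a = g a) : PolyTime g :=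
  funext h ▸ hf

@[fun_prop]
theorem id : PolyTime (fun a : α => a) :=
  ⟨.id, X, fun _ => ⟨_, .id _, by simp [esize]⟩⟩

@[fun_prop]
theorem comp {g : β → γ} {f : α → β} (hg : PolyTime g) (hf : PolyTime f) :
    PolyTime fun a => g (f a) := by
  obtain ⟨s, hs⟩ := hf.size_le
  obtain ⟨P, p, hp⟩ := hf
  obtain ⟨Q, q, hq⟩ := hg
  refine ⟨.comp Q P, X + p + q.comp s, fun a => ?_⟩
  obtain ⟨t, h, ht⟩ := hp a
  obtain ⟨u, k, hu⟩ := hq (f a)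
  refine ⟨_, .comp h k, ?_⟩
  have := hu.trans (eval_mono q (hs a))
  simp only [eval_add, eval_X, eval_comp]
  unfold esize at *
  omega

@[fun_prop]
theorem pair {f : α → β} {g : α → γ} (hf : PolyTime f) (hg : PolyTime g) :
    PolyTime fun a => (f a, g a) := by
  obtain ⟨s, hs⟩ := hf.size_le
  obtain ⟨s', hs'⟩ := hg.size_le
  obtain ⟨P, p, hp⟩ := hf
  obtain ⟨Q, q, hq⟩ := hg
  refine ⟨.pair P Q, X + p + q + (s + s' + 1), fun a => ?_⟩
  obtain ⟨t, h, ht⟩ := hp a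
  obtain ⟨u, k, hu⟩ := hq a
  refine ⟨_, .pair h k, ?_⟩
  have := hs a
  have := hs' a
  simp only [eval_add, eval_X, eval_one, Data.size]
  unfold esize at *
  omega

@[fun_prop]
theorem fst {f : α → β × γ} (hf : PolyTime f) : PolyTime fun a => (f a).1 :=
  comp (g := Prod.fst) ⟨.hd, X, fun a => ⟨_, .hd _, by simp [esize]⟩⟩ hf

@[fun_prop]
theorem snd {f : α → β × γ} (hf : PolyTime f) : PolyTime fun a => (f a).2 :=
  comp (g := Prod.snd) ⟨.tl, X, fun a => ⟨_, .tl _, by simp [esize]⟩⟩ hf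

@[fun_prop]
theorem const (b : β) : PolyTime fun _ : α => b := by
  suffices H : ∀ y : Data, ∃ (P : Prog) (p : ℕ[X]), ∀ x, ∃ t, Run P x y t ∧ t ≤ p.eval x.size by
    obtain ⟨P, p, h⟩ := H (enc b)
    exact ⟨P, p, fun a => h _⟩
  intro y
  induction y with
  | nil => exact ⟨.nil, X, fun x => ⟨_, .nil x, by simp⟩⟩
  | cons y z ihy ihz =>
    obtain ⟨P, p, hp⟩ := ihy
    obtain ⟨Q, q, hq⟩ := ihz
    refine ⟨.pair P Q, X + p + q + C (Data.cons y z).size, fun x => ?_⟩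
    obtain ⟨t, h, ht⟩ := hp x
    obtain ⟨u, k, hu⟩ := hq x
    refine ⟨_, .pair h k, ?_⟩
    simp only [eval_add, eval_X, eval_C]
    omega

/-- Equality of encoded values, as a Boolean test. -/
theorem eq [DecidableEq β] {f g : α → β} (hf : PolyTime f) (hg : PolyTime g) :
    PolyTime fun a => decide (f a = g a) := by
  refine comp (g := fun b : β × β => decide (b.1 = b.2)) ⟨.eq, X, fun b => ⟨_, ?_, le_rfl⟩⟩
    (pair hf hg)
  have h := Run.eq (enc b)
  have h' : decide ((enc b).hd = (enc b).tl) = decide (b.1 = b.2) :=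
    decide_eq_decide.2 (enc_injective (α := β)).eq_iff
  rw [h'] at h
  rw [eval_X]
  exact h

/-- A branch only has to be correct on the inputs that the test sends to it. -/
theorem cond_aux {c : α → Data} {f : α → β} {P : Prog} {p : ℕ[X]}
    (hc : ∀ a, ∃ t, Run P (enc a) (c a) t ∧ t ≤ p.eval (esize a))
    {Q R : Prog} {q r : ℕ[X]}
    (hq : ∀ a, c a ≠ .nil → ∃ t, Run Q (enc a) (enc (f a)) t ∧ t ≤ q.eval (esize a))
    (hr : ∀ a, c a = .nil → ∃ t, Run R (enc a) (enc (f a)) t ∧ t ≤ r.eval (esize a)) :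
    PolyTime f := by
  refine ⟨.ite P Q R, X + p + q + r, fun a => ?_⟩
  obtain ⟨t, h, ht⟩ := hc a
  simp only [eval_add, eval_X]
  by_cases hn : c a = .nil
  · obtain ⟨u, k, hu⟩ := hr a hn
    rw [hn] at h
    refine ⟨_, .ite_false h k, ?_⟩
    unfold esize at *
    omega
  · obtain ⟨u, k, hu⟩ := hq a hn
    refine ⟨_, .ite_true h hn k, ?_⟩
    unfold esize at *
    omega

@[fun_prop]
theorem cond {c : α → Bool} {f g : α → β} (hc : PolyTime c) (hf : PolyTime f) (hg : PolyTime g) :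
    PolyTime fun a => bif c a then f a else g a := by
  obtain ⟨P, p, hp⟩ := hc
  obtain ⟨Q, q, hq⟩ := hf
  obtain ⟨R, r, hr⟩ := hg
  refine cond_aux hp (Q := Q) (R := R) (q := q) (r := r) (fun a ha => ?_) fun a ha => ?_
  · have : c a = true := by
      cases h : c a with
      | false => rw [h] at ha; exact absurd rfl ha
      | true => rfl
    rw [this]; exact hq a
  · have : c a = false := Data.ofBool_injective ha
    rw [this]; exact hr a

@[fun_prop]
theorem and {c d : α → Bool} (hc : PolyTime c) (hd : PolyTime d) : PolyTime fun a => c a && d a := by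
  have : PolyTime fun a => bif c a then d a else false := by fun_prop
  refine this.of_eq fun a => ?_
  cases c a <;> rfl

@[fun_prop]
theorem or {c d : α → Bool} (hc : PolyTime c) (hd : PolyTime d) : PolyTime fun a => c a || d a := by
  have : PolyTime fun a => bif c a then true else d a := by fun_prop
  refine this.of_eq fun a => ?_
  cases c a <;> rfl

@[fun_prop]
theorem not {c : α → Bool} (hc : PolyTime c) : PolyTime fun a => !c a := by
  have : PolyTime fun a => bif c a then false else true := by fun_prop
  refine this.of_eq fun a => ?_
  cases c a <;> rfl

/-! ### Lists -/

@[fun_prop]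
theorem cons {f : α → β} {l : α → List β} (hf : PolyTime f) (hl : PolyTime l) :
    PolyTime fun a => f a :: l a := by
  obtain ⟨P, p, h⟩ := pair hf hl
  exact ⟨P, p, h⟩

/-- Case distinction on a list. A non-empty list and the pair of its head and tail have the same
encoding. -/
theorem list_cases {l : α → List β} {f : α → γ} {g : α → β → List β → γ} (hl : PolyTime l)
    (hf : PolyTime f) (hg : PolyTime fun q : α × β × List β => g q.1 q.2.1 q.2.2) :
    PolyTime fun a => match l a with
      | [] => f a
      | b :: m => g a b m := by
  suffices H : PolyTime fun q : α × List β => match q.2 with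
      | [] => f q.1
      | b :: m => g q.1 b m from comp H (pair id hl)
  obtain ⟨P, p, hp⟩ : PolyTime fun q : α × List β => q.2 := by fun_prop
  obtain ⟨R, r, hr⟩ : PolyTime fun q : α × List β => f q.1 := by fun_prop
  obtain ⟨Q, q, hq⟩ := hg
  refine cond_aux hp (Q := Q) (R := R) (q := q) (r := r) ?_ ?_
  · rintro ⟨a, _ | ⟨b, m⟩⟩ h
    · exact absurd rfl h
    · exact hq (a, b, m)
  · rintro ⟨a, _ | ⟨b, m⟩⟩ h
    · exact hr (a, [])
    · cases h

/-- The loop behind `foldl`: its state is the triple of the parameter, the remaining list and the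
current value, and `N` bounds the size of all states. The body only runs on states with a non-empty
list, which is why its input has the type `α × (β × List β) × σ`, with the same encoding. -/
theorem foldl_loop {f : α → σ → β → σ} {P : Prog} {p : ℕ[X]}
    (hP : ∀ q : α × (β × List β) × σ,
      ∃ t, Run P (enc q) (enc (q.1, q.2.1.2, f q.1 q.2.2 q.2.1.1)) t ∧ t ≤ p.eval (esize q))
    (a : α) (N : ℕ) (l : List β) (s : σ)
    (hN : ∀ m, m <+: l → esize a + esize l + esize (m.foldl (f a) s) + 2 ≤ N) :
    ∃ t, Run (.while (.comp .hd .tl) P) (enc (a, l, s)) (enc (a, ([] : List β), l.foldl (f a) s)) t ∧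
      t ≤ (l.length + 1) * (4 * N + p.eval N) := by
  induction l generalizing s with
  | nil =>
    have h₁ := hN [] (by simp)
    refine ⟨_, .while_false (.comp (.tl _) (.hd _)), ?_⟩
    have h₂ : (enc (a, ([] : List β), s)).size ≤ N := by
      change esize (a, ([] : List β), s) ≤ N
      simp at h₁ ⊢; omega
    have := (enc (a, ([] : List β), s)).size_tl_le
    simp only [List.length_nil, zero_add, one_mul]
    omega
  | cons b l ih =>
    have h₁ := hN [] (by simp)
    obtain ⟨t, h, ht⟩ := hP (a, (b, l), s)
    obtain ⟨u, k, hu⟩ := ih (f a s b) fun m hm => by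
      have := hN (b :: m) (by simpa using hm)
      simp at this ⊢; omega
    refine ⟨_, .while_true (.comp (.tl _) (.hd _)) ?_ h k, ?_⟩
    · exact fun h => Data.noConfusion h
    · have h₂ : (enc (a, b :: l, s)).size ≤ N := by
        change esize (a, b :: l, s) ≤ N
        simp at h₁ ⊢; omega
      have := (enc (a, b :: l, s)).size_tl_le
      have h₃ := ht.trans (eval_mono p (show esize (a, (b, l), s) ≤ N from h₂))
      rw [List.length_cons, add_mul _ 1]
      omega

/-- A fold is computed in polynomial time if the sizes of all its intermediate values are bounded
by a polynomial. -/
theorem foldl {f : α → σ → β → σ} {l : α → List β} {i : α → σ}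
    (hf : PolyTime fun q : α × σ × β => f q.1 q.2.1 q.2.2) (hl : PolyTime l) (hi : PolyTime i)
    (hb : ∃ r : ℕ[X], ∀ a m, m <+: l a → esize (m.foldl (f a) (i a)) ≤ r.eval (esize a)) :
    PolyTime fun a => (l a).foldl (f a) (i a) := by
  obtain ⟨P, p, hP⟩ : PolyTime fun q : α × (β × List β) × σ =>
      (q.1, q.2.1.2, f q.1 q.2.2 q.2.1.1) := by
    have : PolyTime fun q : α × (β × List β) × σ => f q.1 q.2.2 q.2.1.1 :=
      comp (f := fun q : α × (β × List β) × σ => (q.1, q.2.2, q.2.1.1)) hf (by fun_prop)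
    fun_prop
  obtain ⟨r, hr⟩ := hb
  obtain ⟨s, hs⟩ := hl.size_le
  obtain ⟨Q, q, hQ⟩ : PolyTime fun a => (a, l a, i a) := by fun_prop
  refine ⟨.comp (.comp .tl .tl) (.comp (.while (.comp .hd .tl) P) Q),
    2 * X + q + ((s + 1) * (4 * (X + s + r + 2) + p.comp (X + s + r + 2))) + 3 * (X + s + r + 2),
    fun a => ?_⟩
  obtain ⟨t, h, ht⟩ := hQ a
  have hN : ∀ m, m <+: l a → esize a + esize (l a) + esize (m.foldl (f a) (i a)) + 2 ≤
      (X + s + r + 2).eval (esize a) := fun m hm => by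
    have h₁ := hs a
    have h₂ := hr a m hm
    simp only [eval_add, eval_X, eval_ofNat]
    omega
  obtain ⟨u, k, hu⟩ := foldl_loop hP a _ (l a) (i a) hN
  refine ⟨_, .comp (.comp h k) (.comp (.tl _) (.tl _)), ?_⟩
  have h₁ : ((l a).length + 1) * (4 * (X + s + r + 2).eval (esize a) +
      p.eval ((X + s + r + 2).eval (esize a))) ≤
      ((s + 1) * (4 * (X + s + r + 2) + p.comp (X + s + r + 2))).eval (esize a) := by
    simp only [eval_add, eval_X, eval_ofNat, eval_mul, eval_comp, eval_one]
    gcongr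
    exact (length_le_esize _).trans (hs a)
  have h₂ := (enc (a, ([] : List β), (l a).foldl (f a) (i a))).size_tl_le
  have h₃ : (enc (a, ([] : List β), (l a).foldl (f a) (i a))).size ≤
      (X + s + r + 2).eval (esize a) := by
    refine le_trans ?_ (hN _ List.prefix_rfl)
    change esize (a, ([] : List β), (l a).foldl (f a) (i a)) ≤ _
    have := one_le_esize (l a)
    simp
    omega
  have h₄ : (2 * X + q + ((s + 1) * (4 * (X + s + r + 2) + p.comp (X + s + r + 2))) +
      3 * (X + s + r + 2)).eval (esize a) = 2 * esize a + q.eval (esize a) +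
      ((s + 1) * (4 * (X + s + r + 2) + p.comp (X + s + r + 2))).eval (esize a) +
      3 * (X + s + r + 2).eval (esize a) := by
    simp only [eval_add, eval_mul, eval_X, eval_ofNat]
  rw [h₄]
  have h₅ : (enc a).size = esize a := rfl
  omega

@[fun_prop]
theorem reverse {l : α → List β} (hl : PolyTime l) : PolyTime fun a => (l a).reverse := by
  refine comp (g := List.reverse) ?_ hl
  have : PolyTime fun l : List β => l.foldl (fun s b => b :: s) [] := by
    refine foldl (f := fun _ s b => b :: s) (by fun_prop) (by fun_prop) (by fun_prop)
      ⟨X, fun l m hm => ?_⟩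
    have h : ∀ m s : List β, esize (m.foldl (fun s b => b :: s) s) + 1 = esize m + esize s := by
      intro m
      induction m with
      | nil => intro s; simp; omega
      | cons b m ih => intro s; rw [List.foldl_cons, ih]; simp; omega
    have := h m []
    have := esize_le_of_sublist hm.sublist
    simp at *; omega
  refine this.of_eq fun l => ?_
  simp

theorem foldr {f : α → β → σ → σ} {l : α → List β} {i : α → σ}
    (hf : PolyTime fun q : α × β × σ => f q.1 q.2.1 q.2.2) (hl : PolyTime l) (hi : PolyTime i)
    (hb : ∃ r : ℕ[X], ∀ a m, m <:+ l a → esize (m.foldr (f a) (i a)) ≤ r.eval (esize a)) :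
    PolyTime fun a => (l a).foldr (f a) (i a) := by
  have : PolyTime fun a => (l a).reverse.foldl (fun s b => f a b s) (i a) := by
    refine foldl (f := fun a s b => f a b s) ?_ (by fun_prop) hi ?_
    · exact comp (f := fun q : α × σ × β => (q.1, q.2.2, q.2.1)) hf (by fun_prop)
    · obtain ⟨r, hr⟩ := hb
      refine ⟨r, fun a m hm => ?_⟩
      have := hr a m.reverse (by simpa using List.reverse_suffix.2 hm)
      simpa using this
  refine this.of_eq fun a => ?_
  simp

@[fun_prop]
theorem any {p : α → β → Bool} {l : α → List β} (hp : PolyTime fun q : α × β => p q.1 q.2)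
    (hl : PolyTime l) : PolyTime fun a => (l a).any fun b => p a b := by
  have : PolyTime fun a => (l a).foldr (fun b s => p a b || s) false := by
    refine foldr (f := fun a b s => p a b || s) ?_ hl (by fun_prop)
      ⟨3, fun a m _ => by simpa using esize_bool_le _⟩
    have : PolyTime fun q : α × β × Bool => p q.1 q.2.1 :=
      comp (f := fun q : α × β × Bool => (q.1, q.2.1)) hp (by fun_prop)
    fun_prop
  refine this.of_eq fun a => ?_
  induction l a with
  | nil => rfl
  | cons b m ih => simp [← ih]

@[fun_prop]
theorem all {p : α → β → Bool} {l : α → List β} (hp : PolyTime fun q : α × β => p q.1 q.2)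
    (hl : PolyTime l) : PolyTime fun a => (l a).all fun b => p a b := by
  have : PolyTime fun a => !(l a).any fun b => !p a b := by fun_prop
  exact this.of_eq fun a => List.all_eq_not_any_not.symm

@[fun_prop]
theorem filter {p : α → β → Bool} {l : α → List β} (hp : PolyTime fun q : α × β => p q.1 q.2)
    (hl : PolyTime l) : PolyTime fun a => (l a).filter fun b => p a b := by
  have key : ∀ a, ∀ m : List β,
      m.foldr (fun b s => bif p a b then b :: s else s) [] = m.filter fun b => p a b := by
    intro a m
    induction m with
    | nil => rfl
    | cons b m ih => rw [List.foldr_cons, ih, List.filter_cons]; cases p a b <;> rfl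
  have : PolyTime fun a => (l a).foldr (fun b s => bif p a b then b :: s else s) [] := by
    obtain ⟨r, hr⟩ := hl.size_le
    refine foldr (f := fun a b s => bif p a b then b :: s else s) ?_ hl (by fun_prop)
      ⟨r, fun a m hm => ?_⟩
    · have : PolyTime fun q : α × β × List β => p q.1 q.2.1 :=
        comp (f := fun q : α × β × List β => (q.1, q.2.1)) hp (by fun_prop)
      fun_prop
    · rw [key]
      exact (esize_le_of_sublist (List.filter_sublist.trans hm.sublist)).trans (hr a)
  refine this.of_eq fun a => ?_
  exact key a _

@[fun_prop]
theorem append {l m : α → List β} (hl : PolyTime l) (hm : PolyTime m) :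
    PolyTime fun a => l a ++ m a := by
  have : PolyTime fun a => (l a).foldr (fun b s => b :: s) (m a) := by
    obtain ⟨r, hr⟩ := hl.size_le
    obtain ⟨r', hr'⟩ := hm.size_le
    refine foldr (f := fun _ b s => b :: s) (by fun_prop) hl hm ⟨r + r', fun a k hk => ?_⟩
    have h₁ := esize_append k (m a)
    have h₂ := esize_le_of_sublist hk.sublist
    have h₃ := hr a
    have h₄ := hr' a
    simp
    omega
  refine this.of_eq fun a => ?_
  simp

@[fun_prop]
theorem flatMap {f : α → β → List γ} {l : α → List β} (hf : PolyTime fun q : α × β => f q.1 q.2)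
    (hl : PolyTime l) : PolyTime fun a => (l a).flatMap fun b => f a b := by
  have : PolyTime fun a => (l a).foldr (fun b s => f a b ++ s) [] := by
    obtain ⟨r, hr⟩ := hl.size_le
    obtain ⟨s, hs⟩ := hf.size_le
    refine foldr (f := fun a b s => f a b ++ s) ?_ hl (by fun_prop)
      ⟨1 + r * s.comp (X + r + 1), fun a k hk => ?_⟩
    · have : PolyTime fun q : α × β × List γ => f q.1 q.2.1 :=
        comp (f := fun q : α × β × List γ => (q.1, q.2.1)) hf (by fun_prop)
      fun_prop
    · have h₁ : ∀ b ∈ k, esize (f a b) ≤ (s.comp (X + r + 1)).eval (esize a) := fun b hb => by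
        refine (hs (a, b)).trans ?_
        simp only [eval_comp, eval_add, eval_X, eval_one, esize_mk]
        refine eval_mono _ ?_
        have := esize_le_of_mem (hk.subset hb)
        have := hr a
        omega
      have h₂ : k.length ≤ r.eval (esize a) :=
        hk.length_le.trans ((length_le_esize _).trans (hr a))
      have h₃ : esize (k.foldr (fun b s => f a b ++ s) []) ≤
          1 + k.length * (s.comp (X + r + 1)).eval (esize a) := by
        clear h₂ hk
        induction k with
        | nil => simp
        | cons b k ih =>
          have h₄ := ih fun c hc => h₁ c (by simp [hc])
          have h₅ := h₁ b (by simp)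
          have h₆ := esize_append (f a b) (k.foldr (fun b s => f a b ++ s) [])
          simp only [List.foldr_cons, List.length_cons, add_mul]
          omega
      refine h₃.trans ?_
      rw [eval_add, eval_mul, eval_one]
      gcongr
  refine this.of_eq fun a => ?_
  induction l a with
  | nil => rfl
  | cons b m ih => simp [← ih]

@[fun_prop]
theorem map {f : α → β → γ} {l : α → List β} (hf : PolyTime fun q : α × β => f q.1 q.2)
    (hl : PolyTime l) : PolyTime fun a => (l a).map fun b => f a b := by
  have : PolyTime fun a => (l a).flatMap fun b => [f a b] := by fun_prop
  exact this.of_eq fun a => List.map_eq_flatMap.symm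

end PolyTime

/-! ### The algorithm -/

section Algorithm

variable (L : List (List ℕ))

/-- Membership of a node in a list of nodes, as a Boolean test. -/
def mem (x : ℕ) (l : List ℕ) : Bool := l.any fun y => decide (y = x)

/-- Inclusion of lists of nodes, seen as sets. -/
def sub (l m : List ℕ) : Bool := l.all fun x => mem x m

/-- The nodes of a presented hypergraph. -/
def univ : List ℕ := L.flatMap fun e => e

/-- The nodes of the set `s` and the nodes that are `[V]`-adjacent to it. -/
def grow (V s : List ℕ) : List ℕ :=
  (univ L).filter fun y => mem y s ||
    (!mem y V && L.any fun e => mem y e && e.any fun x => mem x s && !mem x V)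

/-- The nodes that a `[V]`-path joins to `x`, found in as many rounds as there are nodes. -/
def reach (V : List ℕ) (x : ℕ) : List ℕ :=
  (univ L).foldr (fun _ s => grow L V s) ((univ L).filter fun y => decide (y = x))

/-- The nodes outside `C` that share a hyperedge with a node of `C`. -/
def bdry (C : List ℕ) : List ℕ :=
  (univ L).filter fun y => !mem y C && L.any fun e => mem y e && e.any fun x => mem x C

/-- The nodes that the Robber reaches from the `[h]`-component of `x` when the squad `h` is
replaced by `h'`. -/
def region (h h' : List ℕ) (x : ℕ) : List ℕ :=
  reach L ((bdry L (reach L h x)).filter fun y => mem y h') x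

/-- An entry of the table: a set of nodes, the root bag and the list of all bags of a tree
decomposition of the hyperedges that meet this set. -/
abbrev Entry := List ℕ × List ℕ × List (List ℕ)

/-- Whether the set `D` absorbs the set `C`: it contains `C`, and its boundary is contained in the
boundary of `C`. -/
def absorbs (D C : List ℕ) : Bool := sub C D && sub (bdry L D) (bdry L C)

/-- Whether some set of the table absorbs `C`. -/
def absorbed (T : List Entry) (C : List ℕ) : Bool := T.any fun e => absorbs L e.1 C

/-- Whether every `[h']`-component that meets the region `R` is absorbed. -/
def ready (T : List Entry) (R h' : List ℕ) : Bool :=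
  R.all fun y => mem y h' || absorbed L T (reach L h' y)

/-- The first table entry that absorbs `C` replaces the entries of `S` that it contains. -/
def insertEntry (T S : List Entry) (C : List ℕ) : List Entry :=
  match T.filter fun e => absorbs L e.1 C with
  | [] => S
  | e :: _ => e :: S.filter fun e' => !sub e'.1 e.1

/-- Entries with disjoint sets that cover `R` outside `h'`. -/
def select (T : List Entry) (R h' : List ℕ) : List Entry :=
  R.foldr (fun y S => bif mem y h' || S.any (fun e => mem y e.1) then S
    else insertEntry L T S (reach L h' y)) []

/-- The union of `R` and of the sets of the entries in `S`. -/
def mergeSet (S : List Entry) (R : List ℕ) : List ℕ :=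
  (univ L).filter fun y => mem y R || S.any fun e => mem y e.1

/-- The part of `h'` in `D` and its boundary, without the nodes in the sets of `S`. -/
def mergeBag (S : List Entry) (D h' : List ℕ) : List ℕ :=
  (univ L).filter fun y => mem y h' && (mem y D || mem y (bdry L D)) &&
    !S.any fun e => mem y e.1

/-- The bag `B` together with the bags of the entries in `S`. They are collected from the root bags
in the table, which keeps their number below the size of the table. -/
def mergeBags (T S : List Entry) (B : List ℕ) : List (List ℕ) :=
  (B :: T.map fun e => e.2.1).filter fun b => decide (b = B) ||
    S.any fun e => e.2.2.any fun b' => decide (b' = b)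

/-- The entry with root bag inside `h'` that is put together from the region `R` and the selected
entries. -/
def merge (T : List Entry) (R h' : List ℕ) : Entry :=
  let S := select L T R h'
  let D := mergeSet L S R
  let B := mergeBag L S D h'
  (D, B, mergeBags T S B)

/-- The triples `(h, x, h')` of a squad (or the empty set), a node, and a next squad. -/
def moves (L₂ : List (List ℕ)) : List (List ℕ × ℕ × List ℕ) :=
  ([] :: L₂).flatMap fun h => (univ L).flatMap fun x => L₂.map fun h' => (h, x, h')

/-- Whether the `[h]`-component of `x` is not yet absorbed. -/
def isOpen (T : List Entry) (m : List ℕ × ℕ × List ℕ) : Bool :=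
  !mem m.2.1 m.1 && !absorbed L T (reach L m.1 m.2.1)

/-- Extend the table by an entry for one component that is not absorbed and has a next squad that
leaves only absorbed components to the Robber, if there is such a component. -/
def extend (L₂ : List (List ℕ)) (T : List Entry) : List Entry :=
  match (moves L L₂).filter fun m => isOpen L T m && ready L T (region L m.1 m.2.2 m.2.1) m.2.2 with
  | [] => T
  | m :: _ => merge L T (region L m.1 m.2.2 m.2.1) m.2.2 :: T

/-- The final table. Each extension absorbs a component of at least one further move, so that the
number of moves is a sufficient number of rounds. -/
def table (L₂ : List (List ℕ)) : List Entry :=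
  (moves L L₂).foldr (fun _ T => extend L L₂ T) []

/-- The list of bags that the algorithm returns. The empty root bag joins the decompositions of the
connected components. -/
def projection (L₂ : List (List ℕ)) : List (List ℕ) :=
  (merge L (table L L₂) (univ L) []).2.2

end Algorithm

/-! ### The running time -/

section Time

variable {α : Type} [Enc α]

@[fun_prop]
theorem polyTime_mem {x : α → ℕ} {l : α → List ℕ} (hx : PolyTime x) (hl : PolyTime l) :
    PolyTime fun a => mem (x a) (l a) :=
  .any (p := fun a y => decide (y = x a)) (.eq (by fun_prop) (by fun_prop)) hl

@[fun_prop]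
theorem polyTime_sub {l m : α → List ℕ} (hl : PolyTime l) (hm : PolyTime m) :
    PolyTime fun a => sub (l a) (m a) := by
  unfold sub; fun_prop

variable {L : α → List (List ℕ)}

@[fun_prop]
theorem polyTime_univ (hL : PolyTime L) : PolyTime fun a => univ (L a) := by
  unfold univ; fun_prop

@[fun_prop]
theorem polyTime_grow (hL : PolyTime L) {V s : α → List ℕ} (hV : PolyTime V) (hs : PolyTime s) :
    PolyTime fun a => grow (L a) (V a) (s a) := by
  unfold grow; fun_prop

@[fun_prop]
theorem polyTime_reach (hL : PolyTime L) {V : α → List ℕ} {x : α → ℕ} (hV : PolyTime V)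
    (hx : PolyTime x) : PolyTime fun a => reach (L a) (V a) (x a) := by
  unfold reach
  obtain ⟨r, hr⟩ := (polyTime_univ hL).size_le
  refine .foldr (f := fun a _ s => grow (L a) (V a) s) (by fun_prop) (by fun_prop)
    (.filter (p := fun a y => decide (y = x a)) (.eq (by fun_prop) (by fun_prop)) (by fun_prop))
    ⟨r, fun a m _ => le_trans ?_ (hr a)⟩
  cases m <;> exact esize_le_of_sublist List.filter_sublist

@[fun_prop]
theorem polyTime_bdry (hL : PolyTime L) {C : α → List ℕ} (hC : PolyTime C) :
    PolyTime fun a => bdry (L a) (C a) := by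
  unfold bdry; fun_prop

@[fun_prop]
theorem polyTime_region (hL : PolyTime L) {h h' : α → List ℕ} {x : α → ℕ} (hh : PolyTime h)
    (hh' : PolyTime h') (hx : PolyTime x) :
    PolyTime fun a => region (L a) (h a) (h' a) (x a) := by
  unfold region; fun_prop

@[fun_prop]
theorem polyTime_absorbs (hL : PolyTime L) {D C : α → List ℕ} (hD : PolyTime D)
    (hC : PolyTime C) : PolyTime fun a => absorbs (L a) (D a) (C a) := by
  unfold absorbs; fun_prop

@[fun_prop]
theorem polyTime_absorbed (hL : PolyTime L) {T : α → List Entry} {C : α → List ℕ}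
    (hT : PolyTime T) (hC : PolyTime C) : PolyTime fun a => absorbed (L a) (T a) (C a) := by
  unfold absorbed; fun_prop

@[fun_prop]
theorem polyTime_ready (hL : PolyTime L) {T : α → List Entry} {R h' : α → List ℕ}
    (hT : PolyTime T) (hR : PolyTime R) (hh' : PolyTime h') :
    PolyTime fun a => ready (L a) (T a) (R a) (h' a) := by
  unfold ready; fun_prop

@[fun_prop]
theorem polyTime_insertEntry (hL : PolyTime L) {T S : α → List Entry} {C : α → List ℕ}
    (hT : PolyTime T) (hS : PolyTime S) (hC : PolyTime C) :
    PolyTime fun a => insertEntry (L a) (T a) (S a) (C a) := by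
  unfold insertEntry
  refine (PolyTime.list_cases (l := fun a => (T a).filter fun e => absorbs (L a) e.1 (C a))
    (f := S) (g := fun a e _ => e :: (S a).filter fun e' => !sub e'.1 e.1)
    (by fun_prop) (by fun_prop) (by fun_prop)).of_eq fun a => ?_
  cases List.filter (fun e => absorbs (L a) e.1 (C a)) (T a) <;> rfl

theorem insertEntry_subset {L : List (List ℕ)} {T S : List Entry} (C : List ℕ) (h : S ⊆ T) :
    insertEntry L T S C ⊆ T := by
  unfold insertEntry
  split
  · exact h
  · rename_i e m he
    have : e ∈ T := List.mem_of_mem_filter (he ▸ List.mem_cons_self)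
    exact List.cons_subset.2 ⟨this, fun e' he' => h (List.mem_of_mem_filter he')⟩

theorem length_insertEntry_le (L : List (List ℕ)) (T S : List Entry) (C : List ℕ) :
    (insertEntry L T S C).length ≤ S.length + 1 := by
  unfold insertEntry
  split
  · omega
  · simpa using List.length_filter_le _ _

/-- The fold that computes `select` keeps a subset of the table, and adds at most one entry at each
step. -/
theorem select_bound (L : List (List ℕ)) (T : List Entry) (R h' : List ℕ) :
    select L T R h' ⊆ T ∧ (select L T R h').length ≤ R.length := by
  unfold select
  induction R with
  | nil => simp
  | cons y R ih =>
    rw [List.foldr_cons]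
    cases mem y h' || List.any _ _
    · exact ⟨insertEntry_subset _ ih.1, (length_insertEntry_le _ _ _ _).trans (by simpa using ih.2)⟩
    · exact ⟨ih.1, ih.2.trans (by simp)⟩

@[fun_prop]
theorem polyTime_select (hL : PolyTime L) {T : α → List Entry} {R h' : α → List ℕ}
    (hT : PolyTime T) (hR : PolyTime R) (hh' : PolyTime h') :
    PolyTime fun a => select (L a) (T a) (R a) (h' a) := by
  obtain ⟨r, hr⟩ := hR.size_le
  obtain ⟨s, hs⟩ := hT.size_le
  refine .foldr (f := fun a y S => bif mem y (h' a) || S.any (fun e => mem y e.1) then S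
    else insertEntry (L a) (T a) S (reach (L a) (h' a) y)) (by fun_prop) hR (by fun_prop)
    ⟨1 + r * (s + 1), fun a m hm => ?_⟩
  obtain ⟨h₁, h₂⟩ := select_bound (L a) (T a) m (h' a)
  refine (esize_list_le (k := s.eval (esize a))
    fun e he => (esize_le_of_mem (h₁ he)).trans (hs a)).trans ?_
  simp only [eval_add, eval_mul, eval_one]
  gcongr
  exact h₂.trans (hm.length_le.trans ((length_le_esize _).trans (hr a)))

@[fun_prop]
theorem polyTime_mergeSet (hL : PolyTime L) {S : α → List Entry} {R : α → List ℕ}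
    (hS : PolyTime S) (hR : PolyTime R) : PolyTime fun a => mergeSet (L a) (S a) (R a) := by
  unfold mergeSet; fun_prop

@[fun_prop]
theorem polyTime_mergeBag (hL : PolyTime L) {S : α → List Entry} {D h' : α → List ℕ}
    (hS : PolyTime S) (hD : PolyTime D) (hh' : PolyTime h') :
    PolyTime fun a => mergeBag (L a) (S a) (D a) (h' a) := by
  unfold mergeBag; fun_prop

@[fun_prop]
theorem polyTime_mergeBags {T S : α → List Entry} {B : α → List ℕ}
    (hT : PolyTime T) (hS : PolyTime S) (hB : PolyTime B) :
    PolyTime fun a => mergeBags (T a) (S a) (B a) := by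
  unfold mergeBags
  have h₁ : PolyTime fun q : α × List ℕ => decide (q.2 = B q.1) := .eq (by fun_prop) (by fun_prop)
  have h₂ : PolyTime fun q : ((α × List ℕ) × Entry) × List ℕ => decide (q.2 = q.1.1.2) :=
    .eq (by fun_prop) (by fun_prop)
  refine .filter (p := fun a b => decide (b = B a) ||
    (S a).any fun e => e.2.2.any fun b' => decide (b' = b)) (.or h₁ (.any
      (p := fun (q : α × List ℕ) (e : Entry) => e.2.2.any fun b' => decide (b' = q.2))
      (.any (p := fun (q : (α × List ℕ) × Entry) (b' : List ℕ) => decide (b' = q.1.2)) h₂ ?_) ?_)) ?_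
  all_goals fun_prop

@[fun_prop]
theorem polyTime_merge (hL : PolyTime L) {T : α → List Entry} {R h' : α → List ℕ}
    (hT : PolyTime T) (hR : PolyTime R) (hh' : PolyTime h') :
    PolyTime fun a => merge (L a) (T a) (R a) (h' a) := by
  unfold merge; fun_prop

@[fun_prop]
theorem polyTime_moves (hL : PolyTime L) {L₂ : α → List (List ℕ)} (hL₂ : PolyTime L₂) :
    PolyTime fun a => moves (L a) (L₂ a) := by
  unfold moves; fun_prop

@[fun_prop]
theorem polyTime_isOpen (hL : PolyTime L) {T : α → List Entry} {m : α → List ℕ × ℕ × List ℕ}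
    (hT : PolyTime T) (hm : PolyTime m) : PolyTime fun a => isOpen (L a) (T a) (m a) := by
  unfold isOpen; fun_prop

@[fun_prop]
theorem polyTime_extend (hL : PolyTime L) {L₂ : α → List (List ℕ)} (hL₂ : PolyTime L₂)
    {T : α → List Entry} (hT : PolyTime T) : PolyTime fun a => extend (L a) (L₂ a) (T a) := by
  unfold extend
  refine (PolyTime.list_cases (l := fun a => (moves (L a) (L₂ a)).filter fun m =>
      isOpen (L a) (T a) m && ready (L a) (T a) (region (L a) m.1 m.2.2 m.2.1) m.2.2)
    (f := T) (g := fun a m _ => merge (L a) (T a) (region (L a) m.1 m.2.2 m.2.1) m.2.2 :: T a)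
    (by fun_prop) (by fun_prop) (by fun_prop)).of_eq fun a => ?_
  generalize List.filter _ (moves (L a) (L₂ a)) = l
  cases l <;> rfl

/-- A bound for the size of the entries in a table with `n` entries, if the nodes of the hypergraph
take size `u`. -/
def entryBound (u n : ℕ) : ℕ := 2 * u + 3 + n * (u + 1)

theorem esize_merge_le (L : List (List ℕ)) {T : List Entry} (R h' : List ℕ)
    (hT : ∀ e ∈ T, esize e.2.1 ≤ esize (univ L)) :
    esize (merge L T R h').2.1 ≤ esize (univ L) ∧
      esize (merge L T R h') ≤ entryBound (esize (univ L)) (T.length + 1) := by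
  have h₁ : esize (merge L T R h').1 ≤ esize (univ L) := esize_le_of_sublist List.filter_sublist
  have h₂ : esize (merge L T R h').2.1 ≤ esize (univ L) := esize_le_of_sublist List.filter_sublist
  refine ⟨h₂, ?_⟩
  have h₃ : esize (merge L T R h').2.2 ≤ 1 + (T.length + 1) * (esize (univ L) + 1) := by
    refine (esize_le_of_sublist List.filter_sublist).trans
      ((esize_list_le (k := esize (univ L)) ?_).trans_eq ?_)
    · rw [List.forall_mem_cons, List.forall_mem_map]
      exact ⟨h₂, hT⟩
    · simp
  rw [esize_pair, esize_pair, entryBound]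
  omega

/-- The bound on the root bags is kept along the way since all bags of a new entry are among them. -/
theorem table_bound (L L₂ : List (List ℕ)) (m : List (List ℕ × ℕ × List ℕ)) :
    (m.foldr (fun _ T => extend L L₂ T) []).length ≤ m.length ∧
    ∀ e ∈ m.foldr (fun _ T => extend L L₂ T) [], esize e.2.1 ≤ esize (univ L) ∧
      esize e ≤ entryBound (esize (univ L)) m.length := by
  induction m with
  | nil => simp
  | cons a m ih =>
    rw [List.foldr_cons, List.length_cons]
    generalize m.foldr (fun _ T => extend L L₂ T) [] = T at ih ⊢
    have mono : ∀ {n}, n ≤ m.length + 1 →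
        entryBound (esize (univ L)) n ≤ entryBound (esize (univ L)) (m.length + 1) := fun h => by
      unfold entryBound; gcongr
    have hT : ∀ e ∈ T, esize e.2.1 ≤ esize (univ L) ∧
        esize e ≤ entryBound (esize (univ L)) (m.length + 1) := fun e he =>
      ⟨(ih.2 e he).1, (ih.2 e he).2.trans (mono (by omega))⟩
    unfold extend
    split
    · exact ⟨by omega, hT⟩
    · rename_i b _ _
      have h := esize_merge_le L (region L b.1 b.2.2 b.2.1) b.2.2 fun e he => (hT e he).1
      exact ⟨by simpa using ih.1, List.forall_mem_cons.2 ⟨⟨h.1, h.2.trans (mono (by omega))⟩, hT⟩⟩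

@[fun_prop]
theorem polyTime_table (hL : PolyTime L) {L₂ : α → List (List ℕ)} (hL₂ : PolyTime L₂) :
    PolyTime fun a => table (L a) (L₂ a) := by
  obtain ⟨r, hr⟩ := (polyTime_moves hL hL₂).size_le
  obtain ⟨s, hs⟩ := (polyTime_univ hL).size_le
  refine .foldr (f := fun a _ T => extend (L a) (L₂ a) T) (by fun_prop) (by fun_prop)
    (by fun_prop) ⟨1 + r * (2 * s + 3 + r * (s + 1) + 1), fun a m hm => ?_⟩
  have h := table_bound (L a) (L₂ a) m
  have hm' := hm.length_le.trans ((length_le_esize _).trans (hr a))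
  refine (esize_list_le fun e he => (h.2 e he).2).trans ?_
  simp only [eval_add, eval_mul, eval_one, eval_ofNat, entryBound]
  have := hs a
  gcongr
  exact h.1.trans hm'

theorem polyTime_projection :
    PolyTime fun a : List (List ℕ) × List (List ℕ) => projection a.1 a.2 := by
  unfold projection; fun_prop

end Time

/-! ### Join trees that grow bag by bag -/

section Grown

variable {α : Type*} [DecidableEq α]

/-- Hypergraphs that arise from the single hyperedge `B₀` by adding hyperedges one at a time, such
that the old nodes of each new hyperedge all lie in one old hyperedge. -/
inductive Grown (B₀ : Finset α) : Hypergraph α → Prop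
  | single : Grown B₀ {B₀}
  | step {H : Hypergraph α} {B X : Finset α} : Grown B₀ H → B ∈ H → X ∩ nodes H ⊆ B →
      Grown B₀ (insert X H)

theorem mem_nodes {H : Hypergraph α} {x : α} : x ∈ nodes H ↔ ∃ h ∈ H, x ∈ h := by
  simp [nodes]

theorem Grown.root_mem {B₀ : Finset α} {H : Hypergraph α} (g : Grown B₀ H) : B₀ ∈ H := by
  induction g with
  | single => simp
  | step _ _ _ ih => exact Finset.mem_insert_of_mem ih

/-- Two grown hypergraphs can be glued along a hyperedge `B` of the first and the root of the
second. -/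
theorem Grown.union {B₀ B B₁ : Finset α} {H H' : Hypergraph α} (g : Grown B₀ H) (hB : B ∈ H)
    (g' : Grown B₁ H') (hn : ∀ x ∈ nodes H, x ∈ nodes H' → x ∈ B ∧ x ∈ B₁) :
    Grown B₀ (H ∪ H') := by
  induction g' with
  | single =>
    rw [Finset.union_comm]
    refine g.step hB fun x hx => ?_
    rw [Finset.mem_inter] at hx
    exact (hn x hx.2 (mem_nodes.2 ⟨B₁, by simp, hx.1⟩)).1
  | @step K Y X k hY hX ih =>
    have hK : ∀ x ∈ nodes K, x ∈ nodes (insert X K) := fun x hx => by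
      obtain ⟨h, hh, hx⟩ := mem_nodes.1 hx
      exact mem_nodes.2 ⟨h, Finset.mem_insert_of_mem hh, hx⟩
    have := ih fun x hx hx' => hn x hx (hK x hx')
    rw [Finset.union_insert]
    refine this.step (Finset.mem_union_right _ hY) fun x hx => ?_
    rw [Finset.mem_inter, mem_nodes] at hx
    obtain ⟨hxX, h, hh, hxh⟩ := hx
    refine hX (Finset.mem_inter.2 ⟨hxX, ?_⟩)
    rcases Finset.mem_union.1 hh with hh | hh
    · have := hn x (mem_nodes.2 ⟨h, hh, hxh⟩) (mem_nodes.2 ⟨X, by simp, hxX⟩)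
      exact mem_nodes.2 ⟨B₁, k.root_mem, this.2⟩
    · exact mem_nodes.2 ⟨h, hh, hxh⟩

/-- Any two vertices in `S` are joined by a walk of `G` inside `S`. -/
def ConnectedIn {V : Type*} (G : SimpleGraph V) (S : Set V) : Prop :=
  ∀ a ∈ S, ∀ b ∈ S, Relation.ReflTransGen (fun x y => G.Adj x y ∧ x ∈ S ∧ y ∈ S) a b

theorem ConnectedIn.mono {V : Type*} {G G' : SimpleGraph V} {S : Set V} (h : ConnectedIn G S)
    (hG : G ≤ G') : ConnectedIn G' S :=
  fun a ha b hb => Relation.ReflTransGen.mono (fun _ _ h => ⟨hG h.1, h.2⟩) _ _ (h a ha b hb)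

theorem ConnectedIn.insert_vertex {V : Type*} {G : SimpleGraph V} {S : Set V} {u v : V}
    (h : ConnectedIn G S) (hu : u ∈ S) (huv : G.Adj u v) : ConnectedIn G (insert v S) := by
  have hS : ∀ a ∈ S, ∀ b ∈ S, Relation.ReflTransGen
      (fun x y => G.Adj x y ∧ x ∈ insert v S ∧ y ∈ insert v S) a b := fun a ha b hb =>
    Relation.ReflTransGen.mono
      (fun _ _ h => ⟨h.1, Set.mem_insert_of_mem _ h.2.1, Set.mem_insert_of_mem _ h.2.2⟩) _ _
      (h a ha b hb)
  have hu' := Set.mem_insert_of_mem v hu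
  have hv' := Set.mem_insert v S
  rintro a (rfl | ha) b (rfl | hb)
  · exact .refl
  · exact .head ⟨huv.symm, hv', hu'⟩ (hS u hu b hb)
  · exact .tail (hS a ha u hu) ⟨huv, hu', hv'⟩
  · exact hS a ha b hb

theorem ConnectedIn.preconnected {V : Type*} {G : SimpleGraph V} {S : Set V} {p : V → Prop}
    (h : ConnectedIn G S) (hp : ∀ x ∈ S, p x) :
    ((G.comap (Subtype.val : {x // p x} → V)).induce {x | x.1 ∈ S}).Preconnected := by
  rintro ⟨⟨a, pa⟩, ha⟩ ⟨⟨b, pb⟩, hb⟩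
  have := h a ha b hb
  clear h
  induction this with
  | refl => rfl
  | @tail c d _ hcd ih =>
    exact (ih (hp c hcd.2.1) hcd.2.1).trans (SimpleGraph.Adj.reachable (by simpa using hcd.1))

/-- The tree is built on the type of all finite sets, where the sets outside `H` are isolated
vertices. -/
theorem Grown.exists_forest {B₀ : Finset α} {H : Hypergraph α} (g : Grown B₀ H) :
    ∃ G : SimpleGraph (Finset α), G.IsAcyclic ∧ (∀ a b, G.Adj a b → a ∈ H ∧ b ∈ H) ∧
      ConnectedIn G {h | h ∈ H} ∧ ∀ x, ConnectedIn G {h | h ∈ H ∧ x ∈ h} := by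
  induction g with
  | single =>
    refine ⟨⊥, ?_, by simp, ?_, fun x => ?_⟩
    · intro v c hc
      exact hc.not_nil (by cases c with
        | nil => simp
        | cons h _ => exact absurd h (by simp))
    · intro a ha b hb
      simp only [Finset.mem_singleton, Set.mem_ofPred_eq] at ha hb
      rw [ha, hb]
    · rintro a ⟨ha, -⟩ b ⟨hb, -⟩
      rw [Finset.mem_singleton] at ha hb
      rw [ha, hb]
  | @step H B X g hB hX ih =>
    by_cases hXH : X ∈ H
    · rwa [Finset.insert_eq_of_mem hXH]
    obtain ⟨G, hac, hadj, hcon, hx⟩ := ih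
    have hBX : B ≠ X := fun h => hXH (h ▸ hB)
    have hle : G ≤ G ⊔ SimpleGraph.edge B X := le_sup_left
    have hedge : (G ⊔ SimpleGraph.edge B X).Adj B X :=
      Or.inr (by simp [SimpleGraph.edge_adj, hBX])
    refine ⟨G ⊔ SimpleGraph.edge B X, hac.sup_edge_of_not_reachable ?_, ?_, ?_, fun x => ?_⟩
    · intro hr
      obtain ⟨p⟩ := hr.symm
      cases p with
      | nil => exact hBX rfl
      | cons h _ => exact hXH (hadj _ _ h).1
    · rintro a b (h | h)
      · exact ⟨Finset.mem_insert_of_mem (hadj _ _ h).1, Finset.mem_insert_of_mem (hadj _ _ h).2⟩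
      · rw [SimpleGraph.edge_adj] at h
        rcases h.1 with ⟨rfl, rfl⟩ | ⟨rfl, rfl⟩ <;> simp [hB]
    · have := (hcon.mono hle).insert_vertex hB hedge
      convert this using 1
      ext h; simp
    · by_cases hxX : x ∈ X
      · by_cases hxH : x ∈ nodes H
        · have hxB : x ∈ B := hX (Finset.mem_inter.2 ⟨hxX, hxH⟩)
          have := ((hx x).mono hle).insert_vertex ⟨hB, hxB⟩ hedge
          convert this using 1
          ext h; simp only [Finset.mem_insert, Set.mem_ofPred_eq, Set.mem_insert_iff]
          constructor
          · rintro ⟨rfl | h, h'⟩ <;> tauto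
          · rintro (rfl | h) <;> tauto
        · have : ∀ h ∈ {h | h ∈ insert X H ∧ x ∈ h}, h = X := by
            rintro h ⟨hh, hxh⟩
            rcases Finset.mem_insert.1 hh with rfl | hh
            · rfl
            · exact absurd (mem_nodes.2 ⟨h, hh, hxh⟩) hxH
          intro a ha b hb
          rw [this a ha, this b hb]
      · convert (hx x).mono hle using 1
        ext h; simp only [Finset.mem_insert, Set.mem_ofPred_eq]
        constructor
        · rintro ⟨rfl | h, h'⟩ <;> tauto
        · tauto

theorem Grown.isAcyclic {B₀ : Finset α} {H : Hypergraph α} (g : Grown B₀ H) : IsAcyclic H := by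
  obtain ⟨G, hac, -, hcon, hx⟩ := g.exists_forest
  refine ⟨G.comap Subtype.val, ⟨?_, hac.of_comap (Function.Embedding.subtype _)⟩, fun x hxn => ?_⟩
  · have := hcon.preconnected (p := fun h => h ∈ H) fun _ h => h
    exact
      { preconnected := fun a b =>
          (this ⟨a, a.2⟩ ⟨b, b.2⟩).map (SimpleGraph.Embedding.induce _).toHom
        nonempty := ⟨⟨B₀, g.root_mem⟩⟩ }
  · obtain ⟨h, hh, hxh⟩ := mem_nodes.1 hxn
    have := (hx x).preconnected (p := fun h => h ∈ H) fun _ h => h.1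
    have hs : {h : {h : Finset α // h ∈ H} | x ∈ h.1} = {y | y.1 ∈ {h | h ∈ H ∧ x ∈ h}} :=
      Set.ext fun y => ⟨fun hy => ⟨y.2, hy⟩, fun hy => hy.2⟩
    rw [hs]
    exact { preconnected := this, nonempty := ⟨⟨⟨h, hh⟩, hh, hxh⟩⟩ }

end Grown

/-! ### Boundaries and components -/

section Components

variable {α : Type*} [DecidableEq α] {H : Hypergraph α}

/-- The nodes outside `C` that share a hyperedge with a node of `C`. -/
def boundary (H : Hypergraph α) (C : Finset α) : Finset α := frontier H C \ C

theorem mem_frontier {C : Finset α} {y : α} :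
    y ∈ frontier H C ↔ ∃ h ∈ H, y ∈ h ∧ ∃ x ∈ h, x ∈ C := by
  simp only [frontier, Finset.mem_biUnion, Finset.mem_filter, id, Finset.Nonempty,
    Finset.mem_inter]
  constructor
  · rintro ⟨h, ⟨hh, x, hx, hxC⟩, hy⟩; exact ⟨h, hh, hy, x, hx, hxC⟩
  · rintro ⟨h, hh, hy, x, hx, hxC⟩; exact ⟨h, ⟨hh, x, hx, hxC⟩, hy⟩

theorem mem_boundary {C : Finset α} {y : α} :
    y ∈ boundary H C ↔ y ∉ C ∧ ∃ h ∈ H, y ∈ h ∧ ∃ x ∈ h, x ∈ C := by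
  rw [boundary, Finset.mem_sdiff, mem_frontier, and_comm]

theorem mem_or_mem_boundary {C h : Finset α} (hh : h ∈ H) {x y : α} (hx : x ∈ h) (hxC : x ∈ C)
    (hy : y ∈ h) : y ∈ C ∨ y ∈ boundary H C := by
  by_cases hyC : y ∈ C
  · exact .inl hyC
  · exact .inr (mem_boundary.2 ⟨hyC, h, hh, hy, x, hx, hxC⟩)

/-- Connectedness of a set of nodes inside itself, in terms of cuts: a set that meets `D` and is
closed under sharing hyperedges inside `D` contains `D`. -/
def IsLinked (H : Hypergraph α) (D : Finset α) : Prop :=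
  ∀ A : Finset α, (∃ x ∈ D, x ∈ A) →
    (∀ h ∈ H, ∀ x ∈ h, x ∈ D → x ∈ A → ∀ y ∈ h, y ∈ D → y ∈ A) → D ⊆ A

/-- A linked set that avoids the boundary of `D` cannot cross it. -/
theorem IsLinked.subset_of_mem {C D : Finset α} (hC : IsLinked H C)
    (hd : ∀ x ∈ C, x ∉ boundary H D) {x : α} (hx : x ∈ C) (hxD : x ∈ D) : C ⊆ D :=
  hC D ⟨x, hx, hxD⟩ fun _ hh _ hz _ hzD y hy hyC =>
    (mem_or_mem_boundary hh hz hzD hy).resolve_right (hd y hyC)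

theorem IsLinked.union {C D : Finset α} (hC : IsLinked H C) (hD : IsLinked H D) {z : α}
    (hzC : z ∈ C) (hzD : z ∈ D) : IsLinked H (C ∪ D) := by
  rintro A ⟨x, hx, hxA⟩ hA
  have hl : ∀ h ∈ H, ∀ x ∈ h, x ∈ C → x ∈ A → ∀ y ∈ h, y ∈ C → y ∈ A :=
    fun h hh x hx hxC hxA y hy hyC => hA h hh x hx (Finset.mem_union_left _ hxC) hxA y hy
      (Finset.mem_union_left _ hyC)
  have hr : ∀ h ∈ H, ∀ x ∈ h, x ∈ D → x ∈ A → ∀ y ∈ h, y ∈ D → y ∈ A :=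
    fun h hh x hx hxC hxA y hy hyC => hA h hh x hx (Finset.mem_union_right _ hxC) hxA y hy
      (Finset.mem_union_right _ hyC)
  rcases Finset.mem_union.1 hx with hx | hx
  · have h₁ := hC A ⟨x, hx, hxA⟩ hl
    exact Finset.union_subset h₁ (hD A ⟨z, hzD, h₁ hzC⟩ hr)
  · have h₁ := hD A ⟨x, hx, hxA⟩ hr
    exact Finset.union_subset (hC A ⟨z, hzC, h₁ hzD⟩ hl) h₁

theorem Path.mem_nodes {V : Finset α} {X Y : α} (p : Path H V X Y) (hX : X ∈ nodes H \ V) :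
    Y ∈ nodes H \ V := by
  induction p with
  | refl => exact hX
  | tail _ h _ =>
    obtain ⟨e, he, -, hb⟩ := h
    rw [Finset.mem_sdiff] at hb ⊢
    exact ⟨RobberCaptain.mem_nodes.2 ⟨e, he, hb.1⟩, hb.2⟩

/-- A path in the complement of the boundary of a set does not leave the set. -/
theorem Path.mem_of_boundary {V C : Finset α} (hb : boundary H C ⊆ V) {X Y : α}
    (p : Path H V X Y) (hX : X ∈ C) : Y ∈ C := by
  induction p with
  | refl => exact hX
  | tail _ h ih =>
    obtain ⟨e, he, ha, hb'⟩ := h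
    rw [Finset.mem_sdiff] at ha hb'
    exact (mem_or_mem_boundary he ha.1 ih hb'.1).resolve_right fun q => hb'.2 (hb q)

theorem IsComponent.boundary_subset {V C : Finset α} (hC : IsComponent H V C) :
    boundary H C ⊆ V := by
  obtain ⟨-, hs, hc, hm⟩ := hC
  intro y hy
  by_contra hyV
  obtain ⟨hyC, h, hh, hyh, x, hx, hxC⟩ := mem_boundary.1 hy
  have hxV := (Finset.mem_sdiff.1 (hs hxC)).2
  have key : ∀ z ∈ insert y C, Path H V x z := by
    intro z hz
    rcases Finset.mem_insert.1 hz with rfl | hz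
    · exact .single ⟨h, hh, Finset.mem_sdiff.2 ⟨hx, hxV⟩, Finset.mem_sdiff.2 ⟨hyh, hyV⟩⟩
    · exact hc x hxC z hz
  refine hyC (hm (insert y C) (Finset.subset_insert _ _) (Finset.insert_subset ?_ hs)
    (fun z hz w hw => (key z hz).symm.trans (key w hw)) ▸ Finset.mem_insert_self _ _)
  exact Finset.mem_sdiff.2 ⟨mem_nodes.2 ⟨h, hh, hyh⟩, hyV⟩

theorem IsComponent.notMem {V C : Finset α} (hC : IsComponent H V C) {x : α} (hx : x ∈ C) :
    x ∉ V := (Finset.mem_sdiff.1 (hC.2.1 hx)).2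

theorem IsComponent.isLinked {V C : Finset α} (hC : IsComponent H V C) : IsLinked H C := by
  rintro A ⟨x, hx, hxA⟩ hA y hy
  have p := hC.2.2.1 x hx y hy
  have : y ∈ C ∧ y ∈ A := by
    clear hy
    induction p with
    | refl => exact ⟨hx, hxA⟩
    | tail q h ih =>
      have hb := Path.mem_of_boundary hC.boundary_subset (q.tail h) hx
      obtain ⟨e, he, ha, hb'⟩ := h
      rw [Finset.mem_sdiff] at ha hb'
      exact ⟨hb, hA e he _ ha.1 ih.1 ih.2 _ hb'.1 hb⟩
  exact this.2

/-- The nodes that are joined to a given node form a component. -/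
theorem isComponent_of_forall_mem_iff {V C : Finset α} {x : α} (hx : x ∈ nodes H \ V)
    (hC : ∀ y, y ∈ C ↔ Path H V x y) : IsComponent H V C := by
  refine ⟨⟨x, (hC x).2 .refl⟩, fun y hy => ((hC y).1 hy).mem_nodes hx,
    fun y hy z hz => ((hC y).1 hy).symm.trans ((hC z).1 hz), fun C' h _ hc => ?_⟩
  exact Finset.Subset.antisymm (fun y hy => (hC y).2 (hc x (h ((hC x).2 .refl)) y hy)) h

theorem IsComponent.mem_iff {V C : Finset α} (hC : IsComponent H V C) {x y : α} (hx : x ∈ C) :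
    y ∈ C ↔ Path H V x y :=
  ⟨hC.2.2.1 x hx y, fun p => p.mem_of_boundary hC.boundary_subset hx⟩

theorem IsComponent.eq_of_mem {V C C' : Finset α} (hC : IsComponent H V C)
    (hC' : IsComponent H V C') {x : α} (hx : x ∈ C) (hx' : x ∈ C') : C = C' := by
  ext y; rw [hC.mem_iff hx, hC'.mem_iff hx']

theorem exists_isComponent {V : Finset α} {x : α} (hx : x ∈ nodes H \ V) :
    ∃ C, IsComponent H V C ∧ x ∈ C := by
  classical
  refine ⟨(nodes H).filter (Path H V x), isComponent_of_forall_mem_iff hx fun y => ?_, ?_⟩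
  · rw [Finset.mem_filter, and_iff_right_of_imp]
    exact fun p => (Finset.mem_sdiff.1 (p.mem_nodes hx)).1
  · exact Finset.mem_filter.2 ⟨(Finset.mem_sdiff.1 hx).1, .refl⟩

end Components

/-! ### Gluing decompositions -/

section Gluing

variable {α : Type*} [DecidableEq α] {H H₂ : Hypergraph α}

/-- `K` consists of the bags, each inside a hyperedge of `H₂`, of a tree decomposition of the
hyperedges of `H` that meet `D`. The root bag contains the boundary of `D`. -/
structure Decomposes (H H₂ : Hypergraph α) (D root : Finset α) (K : Hypergraph α) : Prop where
  grown : Grown root K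
  boundary_subset : boundary H D ⊆ root
  bag_subset : ∀ b ∈ K, ∀ x ∈ b, x ∈ D ∨ x ∈ boundary H D
  coveredBy : CoveredBy K H₂
  covers : ∀ h ∈ H, ∀ x ∈ h, x ∈ D → ∃ b ∈ K, h ⊆ b

/-- `D` contains `C`, and every node on the boundary of `D` is on the boundary of `C`. -/
def Absorbs (H : Hypergraph α) (D C : Finset α) : Prop :=
  C ⊆ D ∧ boundary H D ⊆ boundary H C

/-- Two sets that absorb components of the same set `V` do not cross, unless each contains the
component that the other one absorbs. -/
theorem Absorbs.subset_or_disjoint {V C D C' D' : Finset α} (hC : IsComponent H V C)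
    (hD : Absorbs H D C) (hC' : IsComponent H V C') (hD' : Absorbs H D' C') (hl : IsLinked H D')
    {y : α} (hy : y ∈ C) (hyD : y ∉ D') : D' ⊆ D ∨ ∀ x ∈ D', x ∉ D := by
  by_contra! hcon
  obtain ⟨hn, x, hxD', hxD⟩ := hcon
  refine hn (hl.subset_of_mem (fun z hz hzD => ?_) hxD' hxD)
  have hV : ∀ w ∈ C, w ∉ boundary H D' := fun w hw hw' =>
    hC.notMem hw (hC'.boundary_subset (hD'.2 hw'))
  obtain ⟨-, h, hh, hzh, w, hw, hwC⟩ := mem_boundary.1 (hD.2 hzD)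
  rcases mem_or_mem_boundary hh hzh hz hw with hwD | hwD
  · exact hyD (hC.isLinked.subset_of_mem hV hwC hwD hy)
  · exact hV w hwC hwD

/-- A disjoint family of decomposed sets, each absorbing a `[V]`-component inside `R`, that cover
the nodes of `R` outside `V`, is put together to a decomposition of `R` and all these sets. -/
theorem Decomposes.glue {ι : Type*} {S : List ι} {D root : ι → Finset α} {K : ι → Hypergraph α}
    {V R D' B : Finset α} {K' : Hypergraph α} (hV : ∃ h ∈ H₂, V ⊆ h) (hR : boundary H R ⊆ V)
    (hS : ∀ i ∈ S, ∃ C, IsComponent H V C ∧ C ⊆ R ∧ Absorbs H (D i) C)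
    (hK : ∀ i ∈ S, Decomposes H H₂ (D i) (root i) (K i))
    (hdisj : S.Pairwise fun i j => ∀ x ∈ D i, x ∉ D j)
    (hcov : ∀ x ∈ R, x ∉ V → ∃ i ∈ S, x ∈ D i)
    (hD' : ∀ x, x ∈ D' ↔ x ∈ R ∨ ∃ i ∈ S, x ∈ D i)
    (hB : ∀ x, x ∈ B ↔ x ∈ V ∧ (x ∈ D' ∨ x ∈ boundary H D') ∧ ∀ i ∈ S, x ∉ D i)
    (hK' : ∀ b, b ∈ K' ↔ b = B ∨ ∃ i ∈ S, b ∈ K i) :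
    boundary H D' ⊆ boundary H R ∧ Decomposes H H₂ D' B K' := by
  have hbV : ∀ i ∈ S, boundary H (D i) ⊆ V := fun i hi => by
    obtain ⟨C, hC, -, hD⟩ := hS i hi
    exact hD.2.trans hC.boundary_subset
  have hbR : ∀ i ∈ S, ∀ x ∈ boundary H (D i), x ∈ R ∨ x ∈ boundary H R := fun i hi x hx => by
    obtain ⟨C, hC, hCR, hD⟩ := hS i hi
    obtain ⟨-, h, hh, hxh, y, hy, hyC⟩ := mem_boundary.1 (hD.2 hx)
    exact mem_or_mem_boundary hh hy (hCR hyC) hxh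
  have hsub : ∀ i ∈ S, ∀ h ∈ H, ∀ x ∈ h, x ∈ D i → ∀ y ∈ h, y ∈ D' ∨ y ∈ boundary H D' :=
    fun i hi h hh x hx hxD y hy =>
      mem_or_mem_boundary hh hx ((hD' x).2 (.inr ⟨i, hi, hxD⟩)) hy
  have hbD : boundary H D' ⊆ boundary H R := fun x hx => by
    obtain ⟨hxD, h, hh, hxh, y, hy, hyD⟩ := mem_boundary.1 hx
    rw [hD'] at hxD hyD
    push Not at hxD
    rcases hyD with hyR | ⟨i, hi, hyi⟩
    · exact mem_boundary.2 ⟨hxD.1, h, hh, hxh, y, hy, hyR⟩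
    · exact (hbR i hi x ((mem_or_mem_boundary hh hy hyi hxh).resolve_left (hxD.2 i hi))).resolve_left
        hxD.1
  have hne : ∀ i ∈ S, ∀ j ∈ S, ∀ x ∈ D i, x ∉ boundary H (D j) := fun i hi j hj x hx hxj => by
    obtain ⟨C, hC, -, hD⟩ := hS j hj
    obtain ⟨hxD, h, hh, hxh, y, hy, hyC⟩ := mem_boundary.1 (hD.2 hxj)
    have hij : i ≠ j := fun h => (mem_boundary.1 hxj).1 (h ▸ hx)
    have : Std.Symm fun i j => ∀ x ∈ D i, x ∉ D j := ⟨fun i j h x hx hx' => h x hx' hx⟩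
    have hd : ∀ y ∈ D i, y ∉ D j := hdisj.forall hi hj hij
    -- The hyperedge through `x` and the component `C` would lead from `D i` into `D j`.
    rcases mem_or_mem_boundary hh hxh hx hy with hyi | hyi
    · exact hd y hyi (hD.1 hyC)
    · exact hC.notMem hyC (hbV i hi hyi)
  refine ⟨hbD, ?_, ?_, ?_, ?_, ?_⟩
  · have key : ∀ S' : List ι, S' ⊆ S → S'.Pairwise (fun i j => ∀ x ∈ D i, x ∉ D j) →
        Grown B (insert B ((S'.map K).toFinset.biUnion id)) := by
      intro S'
      induction S' with
      | nil => intro _ _; exact .single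
      | cons i S' ih =>
        intro hS' hp
        obtain ⟨hi, hS'⟩ := List.cons_subset.1 hS'
        obtain ⟨hpi, hp⟩ := List.pairwise_cons.1 hp
        have := (ih hS' hp).union (Finset.mem_insert_self _ _) (hK i hi).grown fun x hx hx' => by
          obtain ⟨b, hb, hxb⟩ := mem_nodes.1 hx
          obtain ⟨b', hb', hxb'⟩ := mem_nodes.1 hx'
          have hb : b = B ∨ ∃ j ∈ S', b ∈ K j := by simpa using hb
          have hxi : x ∉ D i := by
            intro hxi
            rcases hb with rfl | ⟨j, hj, hbj⟩
            · exact ((hB x).1 hxb).2.2 i hi hxi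
            · rcases (hK j (hS' hj)).bag_subset b hbj x hxb with h | h
              · exact hpi j hj x hxi h
              · exact hne i hi j (hS' hj) x hxi h
          have hxb := ((hK i hi).bag_subset b' hb' x hxb').resolve_left hxi
          refine ⟨(hB x).2 ⟨hbV i hi hxb, ?_, fun j hj hxj => hne j hj i hi x hxj hxb⟩,
            (hK i hi).boundary_subset hxb⟩
          obtain ⟨-, h, hh, hxh, y, hy, hyD⟩ := mem_boundary.1 hxb
          exact hsub i hi h hh y hy hyD x hxh
        convert this using 1
        ext b; simp [or_comm (a := b ∈ K i)]
    convert key S (List.Subset.refl _) hdisj using 1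
    ext b; simp [hK']
  · intro x hx
    refine (hB x).2 ⟨hR (hbD hx), .inr hx, fun i hi hxi => ?_⟩
    exact (mem_boundary.1 hx).1 ((hD' x).2 (.inr ⟨i, hi, hxi⟩))
  · intro b hb x hx
    rcases (hK' b).1 hb with rfl | ⟨i, hi, hb⟩
    · exact ((hB x).1 hx).2.1
    · rcases (hK i hi).bag_subset b hb x hx with h | h
      · exact .inl ((hD' x).2 (.inr ⟨i, hi, h⟩))
      · obtain ⟨-, h, hh, hxh, y, hy, hyD⟩ := mem_boundary.1 h
        exact hsub i hi h hh y hy hyD x hxh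
  · intro b hb
    rcases (hK' b).1 hb with rfl | ⟨i, hi, hb⟩
    · obtain ⟨h, hh, hVh⟩ := hV
      exact ⟨h, hh, fun x hx => hVh ((hB x).1 hx).1⟩
    · exact (hK i hi).coveredBy b hb
  · intro h hh x hx hxD
    by_cases hm : ∃ i ∈ S, ∃ y ∈ h, y ∈ D i
    · obtain ⟨i, hi, y, hy, hyi⟩ := hm
      obtain ⟨b, hb, hhb⟩ := (hK i hi).covers h hh y hy hyi
      exact ⟨b, (hK' b).2 (.inr ⟨i, hi, hb⟩), hhb⟩
    · push Not at hm
      refine ⟨B, (hK' B).2 (.inl rfl), fun y hy => (hB y).2 ⟨?_,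
        mem_or_mem_boundary hh hx hxD hy, fun i hi => hm i hi y hy⟩⟩
      rcases mem_or_mem_boundary hh hx hxD hy with hyD | hyD
      · by_contra hyV
        rcases (hD' y).1 hyD with hyR | ⟨i, hi, hyi⟩
        · obtain ⟨i, hi, hyi⟩ := hcov y hyR hyV
          exact hm i hi y hy hyi
        · exact hm i hi y hy hyi
      · exact hR (hbD hyD)

theorem IsLinked.glue {ι : Type*} {S : List ι} {D : ι → Finset α} {R D' : Finset α}
    (hR : IsLinked H R) (hS : ∀ i ∈ S, IsLinked H (D i) ∧ ∃ x ∈ D i, x ∈ R)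
    (hD' : ∀ x, x ∈ D' ↔ x ∈ R ∨ ∃ i ∈ S, x ∈ D i) : IsLinked H D' := by
  induction S generalizing R with
  | nil =>
    convert hR
    ext x; simp [hD']
  | cons i S ih =>
    rw [List.forall_mem_cons] at hS
    obtain ⟨⟨hi, z, hz, hzR⟩, hS⟩ := hS
    refine ih (hR.union hi hzR hz) (fun j hj => ?_) fun x => ?_
    · obtain ⟨hj, x, hx, hxR⟩ := hS j hj
      exact ⟨hj, x, hx, Finset.mem_union_left _ hxR⟩
    · rw [hD', Finset.mem_union]
      simp only [List.mem_cons, exists_eq_or_imp, or_assoc]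

end Gluing

/-! ### Greedy winning strategies -/

section Greedy

variable {α : Type*} [DecidableEq α] {H₁ H₂ : Hypergraph α}

theorem Strategy.squad_mem_of_inDomain (σ : Strategy H₁ H₂) {v : Config α}
    (hv : InDomain H₁ σ.move v) : v.squad ∈ insert ∅ H₂ ∧ v.cops ⊆ v.squad ∧ v.comp ⊆ nodes H₁ := by
  cases hv with
  | init => simp [initial]
  | step h ho =>
    exact ⟨Finset.mem_insert_of_mem (σ.squad_mem _ h),
      (σ.cops_subset _ h).trans Finset.inter_subset_left, ho.1.2.1.trans Finset.sdiff_subset⟩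

theorem Strategy.finite_domain (σ : Strategy H₁ H₂) : {v | InDomain H₁ σ.move v}.Finite := by
  refine Set.Finite.subset (Set.Finite.image
    (fun q : Finset α × Finset α × Finset α => (⟨q.1, q.2.1, q.2.2⟩ : Config α))
    (Finset.finite_toSet (insert ∅ H₂ ×ˢ ((nodes H₂).powerset ×ˢ (nodes H₁).powerset)))) ?_
  rintro ⟨h, M, C⟩ hv
  obtain ⟨h₁, h₂, h₃⟩ := σ.squad_mem_of_inDomain hv
  refine ⟨(h, M, C), ?_, rfl⟩
  simp only [Finset.coe_product, Set.mem_prod, Finset.mem_coe, Finset.mem_powerset]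
  refine ⟨h₁, fun x hx => ?_, h₃⟩
  rcases Finset.mem_insert.1 h₁ with h₁ | h₁
  · have := h₂ hx
    simp only at h₁ this
    rw [h₁] at this
    simp at this
  · exact mem_nodes.2 ⟨h, h₁, h₂ hx⟩

/-- Induction along the moves of a winning strategy, from the captures backwards. -/
theorem Strategy.IsWinning.induction {σ : Strategy H₁ H₂} (hσ : σ.IsWinning)
    {p : Config α → Prop}
    (step : ∀ v, InDomain H₁ σ.move v → (∀ C, IsOption H₁ v (σ.move v).cops C →
      p ⟨(σ.move v).squad, (σ.move v).cops, C⟩) → p v) :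
    ∀ v, InDomain H₁ σ.move v → p v := by
  have : Finite {v // InDomain H₁ σ.move v} := σ.finite_domain
  let r : {v // InDomain H₁ σ.move v} → {v // InDomain H₁ σ.move v} → Prop :=
    fun w v => Relation.TransGen σ.Arc v.1 w.1
  have : IsTrans _ r := ⟨fun _ _ _ h h' => h'.trans h⟩
  have : Std.Irrefl r := ⟨fun v => hσ v.1⟩
  have wf : WellFounded r := Finite.wellFounded_of_trans_of_irrefl r
  intro v hv
  refine wf.induction (C := fun v => p v.1) ⟨v, hv⟩ fun v ih => step v.1 v.2 fun C hC => ?_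
  exact ih ⟨_, v.2.step hC⟩ (.single ⟨v.2, rfl, rfl, .inl hC⟩)

/-- If the Captain has a greedy winning strategy, then a property holds for all connected components
of the hypergraph as soon as it passes, for each next squad, from the components that the Robber
reaches to his current component. Only components of squads have to be considered: a squad that meets
the Robber's set is kept, and the next move drives him into components of this squad. -/
theorem HasGreedyWinningStrategy.forall_isComponent (hs : HasGreedyWinningStrategy H₁ H₂)
    {p : Finset α → Prop}
    (step : ∀ h ∈ insert ∅ H₂, ∀ C, IsComponent H₁ h C → ∀ h' ∈ H₂,
      (∀ C', IsComponent H₁ h' C' →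
        (∃ X ∈ C, ∃ Y ∈ C', Path H₁ (boundary H₁ C ∩ h') X Y) → p C') → p C) :
    ∀ C, IsComponent H₁ ∅ C → p C := by
  obtain ⟨σ, hg, hw⟩ := hs
  have key := hw.induction (p := fun v => ∀ C, IsComponent H₁ v.squad C → C ⊆ v.comp → p C) ?_
  · exact fun C hC => key _ .init C hC (hC.2.1.trans Finset.sdiff_subset)
  intro v hv ih C hC hCv
  obtain ⟨hsq, hcs, -⟩ := σ.squad_mem_of_inDomain hv
  obtain ⟨hcops, hkeep⟩ := hg v hv
  have hr := σ.squad_mem v hv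
  -- A reachable component of the next squad lies in an option of the Robber.
  have hopt : ∀ C', IsComponent H₁ (σ.move v).squad C' →
      (∃ X ∈ v.comp, ∃ Y ∈ C', Path H₁ (v.cops ∩ (σ.move v).cops) X Y) → p C' := by
    rintro C' hC' ⟨X, hX, Y, hY, q⟩
    have hcr : (σ.move v).cops ⊆ (σ.move v).squad := hcops ▸ Finset.inter_subset_left
    have hYn := Finset.mem_sdiff.1 (hC'.2.1 hY)
    obtain ⟨E, hE, hYE⟩ := exists_isComponent (H := H₁) (V := (σ.move v).cops) (x := Y)
      (Finset.mem_sdiff.2 ⟨hYn.1, fun h => hYn.2 (hcr h)⟩)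
    refine ih E ⟨hE, X, hX, Y, hYE, q⟩ C' hC' fun Z hZ => ?_
    exact (hE.mem_iff hYE).2 ((hC'.2.2.1 Y hY Z hZ).mono hcr)
  by_cases hm : (v.squad ∩ v.comp).Nonempty
  · obtain ⟨X, hX⟩ := hC.1
    exact hopt C (hkeep hm ▸ hC) ⟨X, hCv hX, X, hX, .refl⟩
  · refine step v.squad hsq C hC _ hr fun C' hC' ⟨X, hX, Y, hY, q⟩ =>
      hopt C' hC' ⟨X, hCv hX, Y, hY, q.mono ?_⟩
    -- The set `C` is the Robber's whole component, so the cops that stay stand on its boundary.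
    intro x hx
    obtain ⟨hx₁, hx₂⟩ := Finset.mem_inter.1 hx
    rw [hcops] at hx₂
    obtain ⟨hx₂, hx₃⟩ := Finset.mem_inter.1 hx₂
    refine Finset.mem_inter.2 ⟨?_, hx₂⟩
    obtain ⟨h, hh, hxh, y, hy, hyv⟩ := mem_frontier.1 hx₃
    have hvC : v.comp ⊆ C := by
      cases hv with
      | init => simp [initial] at hx₁
      | step hu ho =>
        intro z hz
        have hl := ho.1.isLinked
        refine hl.subset_of_mem (fun w hw hwC => hm ⟨w, ?_⟩) (hCv hX) hX hz
        exact Finset.mem_inter.2 ⟨hC.boundary_subset hwC, hw⟩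
    exact mem_boundary.2 ⟨fun h => hC.notMem h (hcs hx₁), h, hh, hxh, y, hy, hvC hyv⟩

theorem HasGreedyWinningStrategy.nonempty (hs : HasGreedyWinningStrategy H₁ H₂) : H₂.Nonempty := by
  obtain ⟨σ, -, -⟩ := hs
  exact ⟨_, σ.squad_mem _ .init⟩

end Greedy

/-! ### Correctness of the algorithm -/

section Correctness

theorem filter_length_lt {β : Type*} {l : List β} {p q : β → Bool}
    (hpq : ∀ b ∈ l, q b = true → p b = true) {b : β} (hb : b ∈ l) (hp : p b = true)
    (hq : q b = false) : (l.filter q).length < (l.filter p).length := by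
  have h : (l.filter p).filter q = l.filter q := by
    rw [List.filter_filter]
    refine List.filter_congr fun c hc => ?_
    have := hpq c hc
    cases h : q c <;> simp_all
  rw [← h, List.length_filter_lt_length_iff_exists]
  exact ⟨b, List.mem_filter.2 ⟨hb, hp⟩, by simp [hq]⟩

/-- An iteration that decreases a counter until `Q` holds reaches `Q` in as many steps as the
initial value of the counter. -/
theorem iterate_of_decreasing {β : Type*} {f : β → β} {μ : β → ℕ} {I Q : β → Prop}
    (hI : ∀ s, I s → I (f s)) (hQ : ∀ s, Q s → Q (f s))
    (h : ∀ s, I s → Q s ∨ μ (f s) < μ s) (n : ℕ) (s : β) (hs : I s) (hn : μ s ≤ n) :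
    Q (f^[n] s) := by
  induction n generalizing s with
  | zero => exact (h s hs).resolve_right (by omega)
  | succ n ih =>
    rw [Function.iterate_succ_apply]
    rcases h s hs with h | h
    · have : ∀ k t, Q t → Q (f^[k] t) := by
        intro k
        induction k with
        | zero => exact fun _ h => h
        | succ k ih => exact fun t ht => ih _ (hQ t ht)
      exact this n _ (hQ s h)
    · exact ih _ (hI s hs) (by omega)

@[simp] theorem mem_iff {x : ℕ} {l : List ℕ} : mem x l = true ↔ x ∈ l := by simp [mem]

@[simp] theorem mem_eq_false_iff {x : ℕ} {l : List ℕ} : mem x l = false ↔ x ∉ l := by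
  rw [← mem_iff, Bool.not_eq_true]

@[simp] theorem sub_iff {l m : List ℕ} : sub l m = true ↔ l.toFinset ⊆ m.toFinset := by
  simp [sub, Finset.subset_iff]

variable {L L₂ : List (List ℕ)}

theorem mem_ofLists {h : Finset ℕ} : h ∈ ofLists L ↔ ∃ e ∈ L, e.toFinset = h := by
  simp [ofLists]

theorem mem_univ {x : ℕ} : x ∈ univ L ↔ x ∈ nodes (ofLists L) := by
  simp [univ, mem_nodes, mem_ofLists]

theorem mem_grow {V s : List ℕ} {y : ℕ} : y ∈ grow L V s ↔ y ∈ univ L ∧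
    (y ∈ s ∨ ∃ x ∈ s, Adj (ofLists L) V.toFinset x y) := by
  simp only [grow, List.mem_filter, Bool.or_eq_true, mem_iff, Bool.and_eq_true, Bool.not_eq_true',
    mem_eq_false_iff, List.any_eq_true, Adj, mem_ofLists, Finset.mem_sdiff, List.mem_toFinset]
  refine and_congr_right fun _ => or_congr_right ⟨?_, ?_⟩
  · rintro ⟨hy, e, he, hye, x, hx, hxs, hxV⟩
    exact ⟨x, hxs, _, ⟨e, he, rfl⟩, ⟨by simpa using hx, hxV⟩, by simpa using hye, hy⟩
  · rintro ⟨x, hxs, _, ⟨e, he, rfl⟩, ⟨hx, hxV⟩, hye, hy⟩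
    exact ⟨hy, e, he, by simpa using hye, x, by simpa using hx, hxs, hxV⟩

theorem reach_subset {V : List ℕ} {x y : ℕ} (hy : y ∈ reach L V x) : y ∈ univ L := by
  unfold reach at hy
  cases h : univ L with
  | nil => rw [h] at hy; simp at hy
  | cons a l => rw [h, List.foldr_cons, ← h] at hy; rw [← h]; exact (mem_grow.1 hy).1

theorem mem_reach {V : List ℕ} {x y : ℕ} (hx : x ∈ univ L) :
    y ∈ reach L V x ↔ Path (ofLists L) V.toFinset x y := by
  have hfold : reach L V x =
      (grow L V)^[(univ L).length] ((univ L).filter fun y => decide (y = x)) := by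
    rw [reach, List.foldr_const]
  have hsound : ∀ n, x ∈ (grow L V)^[n] ((univ L).filter fun y => decide (y = x)) ∧
      ∀ y ∈ (grow L V)^[n] ((univ L).filter fun y => decide (y = x)),
        Path (ofLists L) V.toFinset x y := by
    intro n
    induction n with
    | zero =>
      simp only [Function.iterate_zero, id, List.mem_filter, decide_eq_true_eq]
      exact ⟨⟨hx, trivial⟩, fun y hy => hy.2 ▸ .refl⟩
    | succ n ih =>
      rw [Function.iterate_succ_apply']
      refine ⟨mem_grow.2 ⟨hx, .inl ih.1⟩, fun y hy => ?_⟩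
      rcases (mem_grow.1 hy).2 with h | ⟨z, hz, h⟩
      · exact ih.2 y h
      · exact (ih.2 z hz).tail h
  have hclosed : ∀ y, y ∈ grow L V (reach L V x) → y ∈ reach L V x := by
    rw [hfold]
    refine iterate_of_decreasing (μ := fun s => ((univ L).filter fun y => !mem y s).length)
      (I := fun _ => True) (Q := fun s => ∀ y, y ∈ grow L V s → y ∈ s) (fun _ _ => trivial)
      (fun s hs y hy => ?_) (fun s _ => ?_) _ _ trivial (List.length_filter_le _ _)
    · rw [mem_grow] at hy
      rcases hy.2 with h | ⟨z, hz, h⟩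
      · exact h
      · exact mem_grow.2 ⟨hy.1, .inr ⟨z, hs z hz, h⟩⟩
    · by_contra! hcon
      obtain ⟨⟨y, hy, hys⟩, hlt⟩ := hcon
      refine absurd (filter_length_lt (fun z hz h => ?_) (mem_grow.1 hy).1 ?_ ?_)
        (not_lt.2 hlt)
      · simp only [Bool.not_eq_true', mem_eq_false_iff] at h ⊢
        exact fun hzs => h (mem_grow.2 ⟨hz, .inl hzs⟩)
      · simpa using hys
      · simpa using hy
  constructor
  · intro hy
    rw [hfold] at hy
    exact (hsound _).2 y hy
  · intro p
    induction p with
    | refl => rw [hfold]; exact (hsound _).1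
    | @tail b c _ h ih =>
      refine hclosed _ (mem_grow.2 ⟨?_, .inr ⟨b, ih, h⟩⟩)
      obtain ⟨e, he, -, hc⟩ := h
      exact mem_univ.2 (mem_nodes.2 ⟨e, he, (Finset.mem_sdiff.1 hc).1⟩)

theorem isComponent_reach {V : List ℕ} {x : ℕ} (hx : x ∈ univ L) (hxV : x ∉ V) :
    IsComponent (ofLists L) V.toFinset (reach L V x).toFinset :=
  isComponent_of_forall_mem_iff (x := x)
    (Finset.mem_sdiff.2 ⟨mem_univ.1 hx, by simpa using hxV⟩)
    fun y => by rw [List.mem_toFinset, mem_reach hx]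

theorem mem_reach_self {V : List ℕ} {x : ℕ} (hx : x ∈ univ L) : x ∈ (reach L V x).toFinset :=
  List.mem_toFinset.2 ((mem_reach hx).2 .refl)

theorem toFinset_bdry (C : List ℕ) : (bdry L C).toFinset = boundary (ofLists L) C.toFinset := by
  ext y
  simp only [bdry, List.mem_toFinset, List.mem_filter, mem_boundary, mem_univ, mem_nodes,
    Bool.and_eq_true, Bool.not_eq_true', mem_eq_false_iff, List.any_eq_true, mem_iff]
  constructor
  · rintro ⟨-, hy, e, he, hye, x, hx, hxC⟩
    exact ⟨hy, _, mem_ofLists.2 ⟨e, he, rfl⟩, by simpa using hye, x, by simpa using hx, hxC⟩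
  · rintro ⟨hy, _, hh, hyh, x, hx, hxC⟩
    obtain ⟨e, he, rfl⟩ := mem_ofLists.1 hh
    exact ⟨⟨_, hh, hyh⟩, hy, e, he, by simpa using hyh, x, by simpa using hx, hxC⟩

theorem absorbs_iff {D C : List ℕ} :
    absorbs L D C = true ↔ Absorbs (ofLists L) D.toFinset C.toFinset := by
  simp [absorbs, Absorbs, toFinset_bdry]

theorem absorbed_iff {T : List Entry} {C : List ℕ} :
    absorbed L T C = true ↔ ∃ e ∈ T, Absorbs (ofLists L) e.1.toFinset C.toFinset := by
  simp [absorbed, absorbs_iff]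

theorem ready_iff {T : List Entry} {R h' : List ℕ} : ready L T R h' = true ↔
    ∀ y ∈ R, y ∉ h' → ∃ e ∈ T, Absorbs (ofLists L) e.1.toFinset (reach L h' y).toFinset := by
  simp [ready, absorbed_iff, or_iff_not_imp_left]

/-- Every entry of the table consists of a linked set of nodes, a root bag and a decomposition, the
bags of which occur as root bags in the table. -/
def Valid (L L₂ : List (List ℕ)) (T : List Entry) : Prop :=
  ∀ e ∈ T, IsLinked (ofLists L) e.1.toFinset ∧
    Decomposes (ofLists L) (ofLists L₂) e.1.toFinset e.2.1.toFinset (ofLists e.2.2) ∧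
    ∀ b ∈ e.2.2, ∃ e' ∈ T, e'.2.1 = b

section Merge

variable {T : List Entry} {R h' : List ℕ}

/-- The selected sets are disjoint, absorb components inside `R`, and cover `R` outside `h'`. A node
`y` that is not covered yet leads to an absorbing set that contains or avoids each of the sets
selected before, and those that it contains are dropped. -/
theorem select_spec (hT : Valid L L₂ T) (hR : ∀ y ∈ R, y ∈ univ L)
    (hb : boundary (ofLists L) R.toFinset ⊆ h'.toFinset) (hr : ready L T R h' = true) :
    (∀ e ∈ select L T R h', e ∈ T ∧ ∃ C, IsComponent (ofLists L) h'.toFinset C ∧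
      C ⊆ R.toFinset ∧ Absorbs (ofLists L) e.1.toFinset C) ∧
    (select L T R h').Pairwise (fun e e' => ∀ x ∈ e.1.toFinset, x ∉ e'.1.toFinset) ∧
    ∀ y ∈ R, y ∉ h' → ∃ e ∈ select L T R h', y ∈ e.1.toFinset := by
  rw [ready_iff] at hr
  -- Induction on the part of `R` that has been processed.
  suffices H : ∀ l : List ℕ, l ⊆ R → ∀ S, S = l.foldr (fun y S =>
      bif mem y h' || S.any (fun e => mem y e.1) then S
      else insertEntry L T S (reach L h' y)) [] →
      (∀ e ∈ S, e ∈ T ∧ ∃ C, IsComponent (ofLists L) h'.toFinset C ∧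
        C ⊆ R.toFinset ∧ Absorbs (ofLists L) e.1.toFinset C) ∧
      S.Pairwise (fun e e' => ∀ x ∈ e.1.toFinset, x ∉ e'.1.toFinset) ∧
      ∀ y ∈ l, y ∉ h' → ∃ e ∈ S, y ∈ e.1.toFinset from H R (List.Subset.refl _) _ rfl
  intro l
  induction l with
  | nil => rintro - S rfl; simp
  | cons y l ih =>
    intro hl S hS
    obtain ⟨hy, hl⟩ := List.cons_subset.1 hl
    rw [List.foldr_cons] at hS
    obtain ⟨ih₁, ih₂, ih₃⟩ := ih hl _ rfl
    generalize l.foldr _ [] = S₀ at hS ih₁ ih₂ ih₃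
    cases hc : mem y h' || S₀.any (fun e => mem y e.1)
    · rw [hc, cond_false, insertEntry] at hS
      simp only [Bool.or_eq_false_iff, mem_eq_false_iff, List.any_eq_false, mem_iff] at hc
      obtain ⟨hyh, hyS⟩ := hc
      have hC := isComponent_reach (V := h') (hR y hy) hyh
      have hyC := mem_reach_self (V := h') (hR y hy)
      have hCR : (reach L h' y).toFinset ⊆ R.toFinset :=
        hC.isLinked.subset_of_mem (fun x hx hxb => hC.notMem hx (hb hxb)) hyC (by simpa using hy)
      split at hS
      · rename_i hnil
        obtain ⟨e, he, hea⟩ := hr y hy hyh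
        exact absurd hnil (List.ne_nil_of_mem (List.mem_filter.2 ⟨he, absorbs_iff.2 hea⟩))
      · rename_i e _ hcons
        have he : e ∈ T.filter fun e => absorbs L e.1 (reach L h' y) := hcons ▸ List.mem_cons_self
        rw [List.mem_filter, absorbs_iff] at he
        subst hS
        refine ⟨?_, ?_, ?_⟩
        · rw [List.forall_mem_cons]
          exact ⟨⟨he.1, _, hC, hCR, he.2⟩, fun e' he' => ih₁ e' (List.mem_of_mem_filter he')⟩
        · refine List.pairwise_cons.2 ⟨fun e' he' x hx hx' => ?_, ih₂.filter _⟩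
          rw [List.mem_filter] at he'
          obtain ⟨heT, C', hC', -, hea⟩ := ih₁ e' he'.1
          rcases he.2.subset_or_disjoint hC hC' hea (hT e' heT).1 hyC
            (by simpa using hyS e' he'.1) with h | h
          · have := sub_iff.2 h
            rw [this] at he'
            simp at he'
          · exact h x hx' hx
        · rw [List.forall_mem_cons]
          refine ⟨fun _ => ⟨e, List.mem_cons_self, he.2.1 hyC⟩, fun z hz hzh => ?_⟩
          obtain ⟨e', he', hz⟩ := ih₃ z hz hzh
          by_cases hs : sub e'.1 e.1 = true
          · exact ⟨e, List.mem_cons_self, sub_iff.1 hs hz⟩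
          · exact ⟨e', List.mem_cons_of_mem _ (List.mem_filter.2
              ⟨he', by simp [Bool.eq_false_of_not_eq_true hs]⟩), hz⟩
    · rw [hc, cond_true] at hS
      subst hS
      refine ⟨ih₁, ih₂, List.forall_mem_cons.2 ⟨fun hyh => ?_, ih₃⟩⟩
      simp only [Bool.or_eq_true, mem_iff, List.any_eq_true] at hc
      obtain ⟨e, he, hye⟩ := hc.resolve_left hyh
      exact ⟨e, he, by simpa using hye⟩

/-- The entry for `R` obeys the conclusions of `Decomposes.glue`. It has all bags of the selected
entries since these are root bags in the table. -/
theorem merge_spec (hT : Valid L L₂ T) (hR : ∀ y ∈ R, y ∈ univ L)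
    (hb : boundary (ofLists L) R.toFinset ⊆ h'.toFinset) (hr : ready L T R h' = true)
    (hV : ∃ h ∈ ofLists L₂, h'.toFinset ⊆ h) :
    R.toFinset ⊆ (merge L T R h').1.toFinset ∧
    boundary (ofLists L) (merge L T R h').1.toFinset ⊆ boundary (ofLists L) R.toFinset ∧
    Decomposes (ofLists L) (ofLists L₂) (merge L T R h').1.toFinset
      (merge L T R h').2.1.toFinset (ofLists (merge L T R h').2.2) ∧
    (IsLinked (ofLists L) R.toFinset → IsLinked (ofLists L) (merge L T R h').1.toFinset) ∧
    ∀ b ∈ (merge L T R h').2.2, b = (merge L T R h').2.1 ∨ ∃ e' ∈ T, e'.2.1 = b := by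
  obtain ⟨h₁, h₂, h₃⟩ := select_spec hT hR hb hr
  unfold merge
  generalize select L T R h' = S at h₁ h₂ h₃
  dsimp only
  have hn : ∀ e ∈ S, ∀ x ∈ e.1, x ∈ univ L := by
    intro e he x hx
    obtain ⟨heT, C, hC, -, ha⟩ := h₁ e he
    obtain ⟨y, hy⟩ := hC.1
    -- A linked set that contains a node of the hypergraph consists of nodes of the hypergraph.
    exact mem_univ.2 ((hT e heT).1 (nodes (ofLists L))
      ⟨y, ha.1 hy, (Finset.mem_sdiff.1 (hC.2.1 hy)).1⟩
      (fun h hh _ _ _ _ z hz _ => mem_nodes.2 ⟨h, hh, hz⟩) (List.mem_toFinset.2 hx))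
  have hD : ∀ x, x ∈ (mergeSet L S R).toFinset ↔
      x ∈ R.toFinset ∨ ∃ e ∈ S, x ∈ e.1.toFinset := by
    intro x
    simp only [mergeSet, List.mem_toFinset, List.mem_filter, Bool.or_eq_true, mem_iff,
      List.any_eq_true, and_iff_right_iff_imp]
    rintro (h | ⟨e, he, h⟩)
    · exact hR x h
    · exact hn e he x h
  have hDn : ∀ x ∈ mergeSet L S R, x ∈ univ L := fun x hx => List.mem_of_mem_filter hx
  generalize mergeSet L S R = D at hD hDn
  have hB : ∀ x, x ∈ (mergeBag L S D h').toFinset ↔ x ∈ h'.toFinset ∧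
      (x ∈ D.toFinset ∨ x ∈ boundary (ofLists L) D.toFinset) ∧ ∀ e ∈ S, x ∉ e.1.toFinset := by
    intro x
    rw [← toFinset_bdry]
    have hbn : ∀ x ∈ bdry L D, x ∈ univ L := fun x hx => List.mem_of_mem_filter hx
    simp only [mergeBag, List.mem_toFinset, List.mem_filter, Bool.and_eq_true, Bool.or_eq_true,
      mem_iff, Bool.not_eq_true', List.any_eq_false, and_assoc, and_iff_right_iff_imp]
    rintro ⟨-, h | h, -⟩
    · exact hDn x h
    · exact hbn x h
  generalize mergeBag L S D h' = B at hB
  have hK : ∀ b, b ∈ mergeBags T S B ↔ b = B ∨ ∃ e ∈ S, b ∈ e.2.2 := by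
    intro b
    simp only [mergeBags, List.mem_filter, List.mem_cons, List.mem_map, Bool.or_eq_true,
      decide_eq_true_eq, List.any_eq_true, exists_eq_right, and_iff_right_iff_imp]
    rintro (h | ⟨e, he, h⟩)
    · exact .inl h
    · exact .inr ((hT e (h₁ e he).1).2.2 b h)
  have hK' : ∀ b, b ∈ ofLists (mergeBags T S B) ↔
      b = B.toFinset ∨ ∃ e ∈ S, b ∈ ofLists e.2.2 := by
    intro b
    simp only [mem_ofLists, hK]
    constructor
    · rintro ⟨c, rfl | ⟨e, he, hc⟩, rfl⟩
      · exact .inl rfl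
      · exact .inr ⟨e, he, c, hc, rfl⟩
    · rintro (rfl | ⟨e, he, c, hc, rfl⟩)
      · exact ⟨B, .inl rfl, rfl⟩
      · exact ⟨c, .inr ⟨e, he, hc⟩, rfl⟩
  obtain ⟨hbd, hdec⟩ := Decomposes.glue (S := S) (D := fun e => e.1.toFinset)
    (root := fun e => e.2.1.toFinset) (K := fun e => ofLists e.2.2) hV hb (fun e he => (h₁ e he).2)
    (fun e he => (hT e (h₁ e he).1).2.1) h₂
    (fun x hx hxV => h₃ x (by simpa using hx) (by simpa using hxV)) hD hB hK'
  refine ⟨fun x hx => (hD x).2 (.inl hx), hbd, hdec, fun hl => hl.glue (fun e he => ?_) hD,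
    fun b hb => ?_⟩
  · obtain ⟨heT, C, hC, hCR, ha⟩ := h₁ e he
    obtain ⟨x, hx⟩ := hC.1
    exact ⟨(hT e heT).1, x, ha.1 hx, hCR hx⟩
  · rcases (hK b).1 hb with rfl | ⟨e, he, hb⟩
    · exact .inl rfl
    · exact .inr ((hT e (h₁ e he).1).2.2 b hb)

end Merge

section Table

/-- The region of a move is a component for the part of `h'` on the boundary of the `[h]`-component
of `x`, so its boundary lies in `h'` and in the boundary of that component. -/
theorem region_spec {h h' : List ℕ} {x : ℕ} (hx : x ∈ univ L) (hxh : x ∉ h) :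
    IsComponent (ofLists L)
      (boundary (ofLists L) (reach L h x).toFinset ∩ h'.toFinset) (region L h h' x).toFinset ∧
    (reach L h x).toFinset ⊆ (region L h h' x).toFinset := by
  have hC := isComponent_reach hx hxh
  have hV : ((bdry L (reach L h x)).filter fun y => mem y h').toFinset =
      boundary (ofLists L) (reach L h x).toFinset ∩ h'.toFinset := by
    rw [← toFinset_bdry]
    ext y; simp
  rw [← hV, region]
  have hxV : x ∉ (bdry L (reach L h x)).filter fun y => mem y h' := fun hm => by
    have := List.mem_toFinset.2 hm
    rw [hV] at this
    exact (mem_boundary.1 (Finset.mem_inter.1 this).1).1 (mem_reach_self hx)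
  have hR := isComponent_reach hx hxV
  refine ⟨hR, hC.isLinked.subset_of_mem (fun y hy hyb => ?_) (mem_reach_self hx)
    (mem_reach_self hx)⟩
  have := hR.boundary_subset hyb
  rw [hV] at this
  exact (mem_boundary.1 (Finset.mem_inter.1 this).1).1 hy

theorem mem_moves {m : List ℕ × ℕ × List ℕ} :
    m ∈ moves L L₂ ↔ m.1 ∈ [] :: L₂ ∧ m.2.1 ∈ univ L ∧ m.2.2 ∈ L₂ := by
  obtain ⟨h, x, h'⟩ := m
  simp only [moves, List.mem_flatMap, List.mem_map, Prod.mk.injEq]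
  constructor
  · rintro ⟨a, ha, b, hb, c, hc, rfl, rfl, rfl⟩; exact ⟨ha, hb, hc⟩
  · rintro ⟨ha, hb, hc⟩; exact ⟨_, ha, _, hb, _, hc, rfl, rfl, rfl⟩

/-- The number of moves from components that are not absorbed is the progress measure. -/
theorem extend_spec {T : List Entry} (hT : Valid L L₂ T) :
    Valid L L₂ (extend L L₂ T) ∧ (extend L L₂ T = T ∨
      ((moves L L₂).filter (isOpen L (extend L L₂ T))).length <
        ((moves L L₂).filter (isOpen L T)).length) := by
  unfold extend
  split
  · exact ⟨hT, .inl rfl⟩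
  rename_i m _ hcons
  have hm : m ∈ (moves L L₂).filter fun m =>
      isOpen L T m && ready L T (region L m.1 m.2.2 m.2.1) m.2.2 := hcons ▸ List.mem_cons_self
  rw [List.mem_filter, Bool.and_eq_true] at hm
  obtain ⟨hmm, ho, hr⟩ := hm
  obtain ⟨-, hx, hh'⟩ := mem_moves.1 hmm
  have ho' := ho
  simp only [isOpen, Bool.and_eq_true, Bool.not_eq_true', mem_eq_false_iff] at ho'
  obtain ⟨hR, hCR⟩ := region_spec (h' := m.2.2) hx ho'.1
  obtain ⟨h₁, h₂, h₃, h₄, h₅⟩ := merge_spec (R := region L m.1 m.2.2 m.2.1) hT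
    (fun y hy => reach_subset hy)
    (hR.boundary_subset.trans Finset.inter_subset_right) hr
    ⟨_, mem_ofLists.2 ⟨_, hh', rfl⟩, Finset.Subset.refl _⟩
  generalize merge L T (region L m.1 m.2.2 m.2.1) m.2.2 = e at h₁ h₂ h₃ h₄ h₅ ⊢
  refine ⟨?_, .inr (filter_length_lt (fun n _ hn => ?_) hmm ho ?_)⟩
  · rw [Valid, List.forall_mem_cons]
    refine ⟨⟨h₄ hR.isLinked, h₃, fun b hb => ?_⟩, fun e' he' => ⟨(hT e' he').1, (hT e' he').2.1,
      fun b hb => ?_⟩⟩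
    · rcases h₅ b hb with rfl | ⟨e', he', h⟩
      · exact ⟨e, List.mem_cons_self, rfl⟩
      · exact ⟨e', List.mem_cons_of_mem _ he', h⟩
    · obtain ⟨e'', he'', h⟩ := (hT e' he').2.2 b hb
      exact ⟨e'', List.mem_cons_of_mem _ he'', h⟩
  · simp only [isOpen, Bool.and_eq_true, Bool.not_eq_true', ← Bool.not_eq_true, absorbed_iff]
      at hn ⊢
    exact ⟨hn.1, fun ⟨e', he', ha⟩ => hn.2 ⟨e', List.mem_cons_of_mem _ he', ha⟩⟩
  · have : absorbed L (e :: T) (reach L m.1 m.2.1) = true := absorbed_iff.2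
      ⟨e, List.mem_cons_self, hCR.trans h₁,
        h₂.trans (hR.boundary_subset.trans Finset.inter_subset_left)⟩
    simp [isOpen, this]

theorem table_spec (L L₂ : List (List ℕ)) :
    Valid L L₂ (table L L₂) ∧ extend L L₂ (table L L₂) = table L L₂ := by
  have hfold : table L L₂ = (extend L L₂)^[(moves L L₂).length] [] := by
    rw [table, List.foldr_const]
  have h₀ : Valid L L₂ [] := fun e he => absurd he List.not_mem_nil
  rw [hfold]
  refine ⟨Function.Iterate.rec (Valid L L₂) h₀ (fun T hT => (extend_spec hT).1) _, ?_⟩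
  exact iterate_of_decreasing (μ := fun T => ((moves L L₂).filter (isOpen L T)).length)
    (I := Valid L L₂) (Q := fun T => extend L L₂ T = T) (fun T hT => (extend_spec hT).1)
    (fun T hT => congrArg _ hT) (fun T hT => (extend_spec hT).2) _ _ h₀ (List.length_filter_le _ _)

/-- When the table is complete, every component with a move that leads to absorbed components only
is itself absorbed. -/
theorem table_closed {m : List ℕ × ℕ × List ℕ} (hm : m ∈ moves L L₂) (hx : m.2.1 ∉ m.1)
    (hr : ready L (table L L₂) (region L m.1 m.2.2 m.2.1) m.2.2 = true) :
    ∃ e ∈ table L L₂, Absorbs (ofLists L) e.1.toFinset (reach L m.1 m.2.1).toFinset := by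
  rw [← absorbed_iff]
  by_contra hn
  have h := (table_spec L L₂).2
  generalize table L L₂ = T at h hr hn
  unfold extend at h
  split at h
  · rename_i hnil
    refine absurd hnil (List.ne_nil_of_mem (List.mem_filter.2 ⟨hm, ?_⟩))
    simp [isOpen, hx, hn, hr]
  · exact absurd (congrArg List.length h) (by simp)

theorem absorbed_of_isComponent (hs : HasGreedyWinningStrategy (ofLists L) (ofLists L₂)) :
    ∀ C, IsComponent (ofLists L) ∅ C →
      ∃ e ∈ table L L₂, Absorbs (ofLists L) e.1.toFinset C := by
  refine hs.forall_isComponent fun h hh C hC h' hh' hopt => ?_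
  obtain ⟨l, hl, rfl⟩ : ∃ l ∈ [] :: L₂, l.toFinset = h := by
    rcases Finset.mem_insert.1 hh with rfl | hh
    · exact ⟨[], by simp, rfl⟩
    · obtain ⟨l, hl, rfl⟩ := mem_ofLists.1 hh
      exact ⟨l, List.mem_cons_of_mem _ hl, rfl⟩
  obtain ⟨l', hl', rfl⟩ := mem_ofLists.1 hh'
  obtain ⟨x, hxC⟩ := hC.1
  obtain ⟨hxn, hxl⟩ := Finset.mem_sdiff.1 (hC.2.1 hxC)
  rw [← mem_univ] at hxn
  rw [List.mem_toFinset] at hxl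
  obtain rfl := (isComponent_reach hxn hxl).eq_of_mem hC (mem_reach_self hxn) hxC
  obtain ⟨hR, hCR⟩ := region_spec (h' := l') hxn hxl
  refine table_closed (m := (l, x, l')) (mem_moves.2 ⟨hl, hxn, hl'⟩) hxl
    (ready_iff.2 fun y hy hyl => ?_)
  have hyn := reach_subset hy
  exact hopt _ (isComponent_reach hyn hyl) ⟨x, hxC, y, mem_reach_self hyn,
    (hR.mem_iff (hCR hxC)).1 (List.mem_toFinset.2 hy)⟩

theorem isTreeProjection_projection
    (hs : HasGreedyWinningStrategy (ofLists L) (ofLists L₂)) :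
    IsTreeProjection (ofLists L) (ofLists L₂) (ofLists (projection L L₂)) := by
  obtain ⟨g, hg⟩ := hs.nonempty
  have hb : boundary (ofLists L) (univ L).toFinset = ∅ := by
    refine Finset.eq_empty_of_forall_notMem fun x hx => ?_
    obtain ⟨hxu, h, hh, hxh, -⟩ := mem_boundary.1 hx
    exact hxu (List.mem_toFinset.2 (mem_univ.2 (mem_nodes.2 ⟨h, hh, hxh⟩)))
  obtain ⟨h₁, -, hdec, -⟩ := merge_spec (R := univ L) (h' := []) (table_spec L L₂).1
    (fun _ h => h) (by rw [hb]; exact Finset.empty_subset _)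
    (ready_iff.2 fun y hy hyn => absorbed_of_isComponent hs _ (isComponent_reach hy hyn))
    ⟨g, hg, by simp⟩
  refine ⟨hdec.grown.isAcyclic, fun h hh => ?_, hdec.coveredBy⟩
  rcases h.eq_empty_or_nonempty with rfl | ⟨x, hx⟩
  · exact ⟨_, hdec.grown.root_mem, Finset.empty_subset _⟩
  · exact hdec.covers h hh x hx
      (h₁ (List.mem_toFinset.2 (mem_univ.2 (mem_nodes.2 ⟨h, hh, hx⟩))))

end Table

end Correctness

end RobberCaptain

theorem theorem4p1 :
    ∃ (P : RobberCaptain.Prog) (p : Polynomial ℕ), ∀ L₁ L₂ : List (List ℕ),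
      ∃ (out : RobberCaptain.Data) (t : ℕ),
        RobberCaptain.Run P (RobberCaptain.encodePair L₁ L₂) out t ∧
        t ≤ p.eval (RobberCaptain.encodePair L₁ L₂).size ∧
        (RobberCaptain.HasGreedyWinningStrategy
            (RobberCaptain.ofLists L₁) (RobberCaptain.ofLists L₂) →
          ∃ La : List (List ℕ), out = RobberCaptain.Data.ofEdges La ∧
            RobberCaptain.IsTreeProjection (RobberCaptain.ofLists L₁) (RobberCaptain.ofLists L₂)
              (RobberCaptain.ofLists La)) := by
  obtain ⟨P, p, h⟩ := RobberCaptain.polyTime_projection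
  refine ⟨P, p, fun L₁ L₂ => ?_⟩
  obtain ⟨t, hr, ht⟩ := h (L₁, L₂)
  exact ⟨_, t, hr, ht, fun hs => ⟨_, rfl, RobberCaptain.isTreeProjection_projection hs⟩⟩
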